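/- Let $m$ be the normalized Lebesgue measure on the unit circle $\mathbb T$, let $H^2\subset L^2(m)$ be the Hardy space (functions whose Fourier coefficients of negative index vanish, identified with their analytic extensions to the unit disk $\mathbb D$), and let $S$ be the operator of multiplication by $z$ on $H^2$. Let $\mu$ be a finite positive Borel measure on $\mathbb T$ which is singular with respect to $m$ and satisfies $\mu(\{1\})=0$, and let $V$ be the operator of multiplication by the independent variable $\xi$ on $L^2(\mu)$. Define $\theta$ on $\mathbb D$ by $$\frac{1+\theta(z)}{1-\theta(z)}=\int_{\mathbb T}\frac{1+\bar\xi z}{1-\bar\xi z}\,d\mu(\xi),\qquad z\in\mathbb D,$$ put $$(\Omega u)(z)=(1-\theta(z))\int_{\mathbb T}\frac{u(\xi)\,d\mu(\xi)}{1-\bar\xi z},\qquad u\in L^2(\mu),\ z\in\mathbb D,$$ and let $g=\Omega\bar\xi$ and $K_\theta=H^2\ominus\theta H^2$. Then $\theta$ is (the analytic extension of) an inner function, i.e. an element of $H^2$ with $|\theta|=1$ $m$-almost everywhere; $g\in K_\theta$; and the operator $$\tilde S=S+(\cdot,g)(1-\theta)$$ on $H^2$ has the following properties. (i) $\tilde S$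 is diagonal with respect to the decomposition $H^2=K_\theta\oplus\theta H^2$, i.e. it maps each of the two summands into itself. (ii) $\tilde S$ acts on $\theta H^2$ as multiplication by $z$. (iii) The restriction of $\tilde S$ to $K_\theta$ is a unitary operator on $K_\theta$, and $1$ is not an eigenvalue of it. Moreover, the restriction of $\tilde S$ to $K_\theta$ is unitarily equivalent to $V$, and $\tilde S$ is unitarily equivalent to $S\oplus V$ on $H^2\oplus L^2(\mu)$. -/

import Mathlib

open MeasureTheory AddCircle
open scoped ENNReal ComplexConjugate

noncomputable section

namespace ClarkModel

/-- The unit circle `𝕋 ⊆ ℂ`, parametrized as `ℝ/ℤ` through `t ↦ ξ = exp (2 π i t)`. The point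
`1 ∈ 𝕋` is `t = 0`. -/
abbrev Torus : Type := UnitAddCircle

/-- The independent variable `ξ` on the circle: `ξ t = exp (2 π i t)`. -/
abbrev xi : C(Torus, ℂ) := fourier 1

theorem xi_coe (x : ℝ) : xi (x : Torus) = Complex.exp (2 * Real.pi * Complex.I * x) := by
  rw [fourier_coe_apply]
  simp

/-- The normalized Lebesgue measure `m` on the circle, `m(𝕋) = 1`. -/
abbrev leb : Measure Torus := haarAddCircle

/-- `L²(μ)` for a measure `μ` on the circle. -/
abbrev L2 (μ : Measure Torus) : Type := Lp ℂ 2 μ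

/-- The operator `V` of multiplication by the independent variable `ξ` on `L²(μ)`. -/
def mulXi (μ : Measure Torus) [IsFiniteMeasure μ] : L2 μ →L[ℂ] L2 μ :=
  (ContinuousLinearMap.mul ℂ ℂ).holderL μ ∞ 2 2 (ContinuousMap.toLp ∞ μ ℂ xi)

theorem coeFn_mulXi (μ : Measure Torus) [IsFiniteMeasure μ] (u : L2 μ) :
    mulXi μ u =ᵐ[μ] fun t => xi t * u t := by
  have h1 := (ContinuousLinearMap.mul ℂ ℂ).coeFn_holder (r := 2)
    (ContinuousMap.toLp ∞ μ ℂ xi) u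
  have h2 := ContinuousMap.coeFn_toLp (p := ∞) (𝕜 := ℂ) μ xi
  filter_upwards [h1, h2] with t h1 h2
  change ((ContinuousLinearMap.mul ℂ ℂ).holder 2 (ContinuousMap.toLp ∞ μ ℂ xi) u) t = _
  rw [h1, h2]
  rfl

/-- The Hardy space `H²`: the functions in `L²(m)` whose Fourier coefficients of negative index
vanish. -/
def H2 : Submodule ℂ (L2 leb) where
  carrier := {f | ∀ n : ℤ, n < 0 → fourierCoeff f n = 0}
  zero_mem' := fun n _ => by rw [← fourierBasis_repr]; simp
  add_mem' := fun {f g} hf hg n hn => by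
    have h1 := hf n hn
    have h2 := hg n hn
    rw [← fourierBasis_repr] at h1 h2 ⊢
    simp [h1, h2]
  smul_mem' := fun c f hf n hn => by
    have h1 := hf n hn
    rw [← fourierBasis_repr] at h1 ⊢
    simp [h1]

theorem mulXi_mem_H2 {f : L2 leb} (hf : f ∈ H2) : mulXi leb f ∈ H2 := by
  intro n hn
  rw [fourierCoeff_congr_ae (coeFn_mulXi leb f)]
  have h : fourierCoeff (fun t => xi t * f t) n = fourierCoeff f (n - 1) := by
    unfold fourierCoeff
    refine integral_congr_ae (Filter.Eventually.of_forall fun t => ?_)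
    simp only [smul_eq_mul]
    rw [← mul_assoc, ← fourier_add, show -n + 1 = -(n - 1) by ring]
  rw [h]
  exact hf (n - 1) (by omega)

/-- The shift operator `S`, multiplication by `z` on `H²`. -/
def shift : H2 →L[ℂ] H2 :=
  (mulXi leb).restrict fun _ hf => mulXi_mem_H2 hf

/-- The value at a point `z` of the open unit disk of (the analytic extension of) `f ∈ H²`. -/
def diskValue (f : H2) (z : ℂ) : ℂ := ∑' n : ℕ, fourierCoeff (f : L2 leb) n * z ^ n

open Classical in
/-- The element of `H²` whose analytic extension to the open unit disk is `F`
(and `0` if `F` does not belong to the Hardy space). -/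
def ofDisk (F : ℂ → ℂ) : H2 :=
  if h : ∃ f : H2, ∀ z : ℂ, ‖z‖ < 1 → diskValue f z = F z then h.choose else 0

theorem one_mem_H2 : (fourierLp 2 0 : L2 leb) ∈ H2 := by
  intro n hn
  rw [fourierCoeff_toLp, fourierCoeff_fourier, Pi.single_eq_of_ne hn.ne]

/-- The constant function `1` as an element of `H²`. -/
def oneH2 : H2 := ⟨fourierLp 2 0, one_mem_H2⟩

/-- An inner function: an element of `H²` which is unimodular `m`-almost everywhere. -/
def IsInner (θ : H2) : Prop := ∀ᵐ t ∂leb, ‖(θ : L2 leb) t‖ = 1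

/-- The subspace `θ H²` of `H²`. -/
def innerRange (θ : H2) : Submodule ℂ H2 where
  carrier := {h | ∃ f : H2, (h : L2 leb) =ᵐ[leb] fun t => (θ : L2 leb) t * (f : L2 leb) t}
  zero_mem' := by
    refine ⟨0, ?_⟩
    filter_upwards [Lp.coeFn_zero ℂ 2 leb] with t ht
    simp only [Submodule.coe_zero, ht, Pi.zero_apply, mul_zero]
  add_mem' := by
    rintro a b ⟨f, hf⟩ ⟨g, hg⟩
    refine ⟨f + g, ?_⟩
    filter_upwards [hf, hg, Lp.coeFn_add (a : L2 leb) (b : L2 leb),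
      Lp.coeFn_add (f : L2 leb) (g : L2 leb)] with t h1 h2 h3 h4
    simp only [Submodule.coe_add, h3, h4, Pi.add_apply, h1, h2, mul_add]
  smul_mem' := by
    rintro c a ⟨f, hf⟩
    refine ⟨c • f, ?_⟩
    filter_upwards [hf, Lp.coeFn_smul c (a : L2 leb), Lp.coeFn_smul c (f : L2 leb)]
      with t h1 h2 h3
    simp only [Submodule.coe_smul, h2, h3, Pi.smul_apply, h1, smul_eq_mul]
    ring

/-- The model subspace `K_θ = H² ⊖ θ H²`. -/
def modelSpace (θ : H2) : Submodule ℂ H2 := (innerRange θ)ᗮ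

/-- The integral `∫ (1 + ξ̄ z) / (1 - ξ̄ z) dμ(ξ)`. -/
def herglotz (μ : Measure Torus) (z : ℂ) : ℂ :=
  ∫ t, (1 + conj (xi t) * z) / (1 - conj (xi t) * z) ∂μ

/-- The solution `θ(z)` of `(1 + θ(z)) / (1 - θ(z)) = ∫ (1 + ξ̄ z) / (1 - ξ̄ z) dμ(ξ)`, as a function
on the open unit disk. -/
def clarkFun (μ : Measure Torus) (z : ℂ) : ℂ := (herglotz μ z - 1) / (herglotz μ z + 1)

/-- The function `θ` with Clark measure `μ`, as an element of `H²`. -/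
def clarkTheta (μ : Measure Torus) : H2 := ofDisk (clarkFun μ)

/-- `(Ω u)(z) = (1 - θ(z)) ∫ u(ξ) / (1 - ξ̄ z) dμ(ξ)`, as a function on the open unit disk. -/
def clarkOmegaFun (μ : Measure Torus) (u : L2 μ) (z : ℂ) : ℂ :=
  (1 - diskValue (clarkTheta μ) z) * ∫ t, u t / (1 - conj (xi t) * z) ∂μ

/-- `Ω u` as an element of `H²`. -/
def clarkOmega (μ : Measure Torus) (u : L2 μ) : H2 := ofDisk (clarkOmegaFun μ u)

/-- The function `ξ̄` as an element of `L²(μ)`. -/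
def xiBar (μ : Measure Torus) [IsFiniteMeasure μ] : L2 μ :=
  ContinuousMap.toLp 2 μ ℂ (star xi)

/-- The function `g = Ω ξ̄`. -/
def clarkG (μ : Measure Torus) [IsFiniteMeasure μ] : H2 := clarkOmega μ (xiBar μ)

/-- The perturbed shift `S̃ = S + (·, g) (1 - θ)`. (Mathlib's inner product is linear in its second
argument, so the functional `(·, g)` is `inner ℂ g`.) -/
def perturbedShift (μ : Measure Torus) [IsFiniteMeasure μ] : H2 →L[ℂ] H2 :=
  shift + (innerSL ℂ (clarkG μ)).smulRight (oneH2 - clarkTheta μ)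

/-- Properties (i), (ii), (iii) of an operator `T` on `H²` with respect to `θ`. -/
structure IsModelPerturbation (θ : H2) (T : H2 →L[ℂ] H2) : Prop where
  /-- (i) `H² = K_θ ⊕ θ H²`, -/
  isCompl : IsCompl (modelSpace θ) (innerRange θ)
  /-- (i) and `T` is diagonal with respect to this decomposition: it preserves `K_θ` -/
  map_modelSpace : ∀ h ∈ modelSpace θ, T h ∈ modelSpace θ
  /-- (i) and it preserves `θ H²`. -/
  map_innerRange : ∀ h ∈ innerRange θ, T h ∈ innerRange θ
  /-- (ii) `T` acts on `θ H²` as multiplication by `z`. -/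
  eq_shift : ∀ h ∈ innerRange θ, T h = shift h
  /-- (iii) The restriction of `T` to `K_θ` is a unitary operator `W` on `K_θ`, and `1` is not an
  eigenvalue of it. -/
  unitary : ∃ W : modelSpace θ ≃ₗᵢ[ℂ] modelSpace θ, (∀ h : modelSpace θ, (W h : H2) = T h) ∧
    ¬ Module.End.HasEigenvalue (W.toLinearEquiv : modelSpace θ →ₗ[ℂ] modelSpace θ) 1

/-- Unitary equivalence of bounded operators on (possibly different) inner product spaces. -/
def UnitarilyEquivalent {E F : Type*} [NormedAddCommGroup E] [InnerProductSpace ℂ E]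
    [NormedAddCommGroup F] [InnerProductSpace ℂ F] (A : E →L[ℂ] E) (B : F →L[ℂ] F) : Prop :=
  ∃ W : E ≃ₗᵢ[ℂ] F, ∀ x : E, W (A x) = B (W x)

/-- The orthogonal direct sum `A ⊕ B` of operators, on the Hilbert space direct sum `E ⊕ F`. -/
def directSum {E F : Type*} [NormedAddCommGroup E] [InnerProductSpace ℂ E]
    [NormedAddCommGroup F] [InnerProductSpace ℂ F] (A : E →L[ℂ] E) (B : F →L[ℂ] F) :
    WithLp 2 (E × F) →L[ℂ] WithLp 2 (E × F) :=
  (WithLp.prodContinuousLinearEquiv 2 ℂ E F).symm.toContinuousLinearMap ∘L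
    (A.prodMap B) ∘L (WithLp.prodContinuousLinearEquiv 2 ℂ E F).toContinuousLinearMap

end ClarkModel

end

open Filter Topology
open scoped InnerProductSpace

noncomputable section

namespace ClarkModel

/-! ### Two facts about Hilbert spaces and power series -/

/-! Write `H` for the Herglotz integral of `μ`. It has nonnegative real part on the disk, so its
Cayley transform `θ = (H - 1) / (H + 1)` is bounded by `1`, and `1 - |θ|² = 4 Re H / |H + 1|² ≤ 4 Re
H`. The measures `Re H(rξ) dm` converge weakly to `μ`; as `μ` lives on an `m`-null set, almost all
of their mass ends up where `m` is tiny, so `∫ |θ(rξ)|² dm` must come close to `1`. Together with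
`|θ| ≤ 1` this makes `θ` inner (`isInner_clarkTheta`).

The second ingredient is that `Ω` is unitary from `L²(μ)` onto `K_θ` (`exists_clark_unitary`).
Evaluation of `Ωu` at `w` is the inner product of `u` with a multiple `k_w` of a Cauchy kernel,
while evaluation on `K_θ` is given by its reproducing kernel. The Herglotz formula shows that both
families of kernels have the same Gram matrix (`inner_cauchyKernel_cauchyKernel`). The reproducing
kernels are total in `K_θ` because disk values determine a function. The `k_w` are total in `L²(μ)`
because analytic polynomials are dense there for singular `μ` (`eq_zero_of_forall_integral_pow`).
Hence a unitary operator matches the two families, and its disk values are those of `Ωu`.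

Finally, `ξ / (1 - ξ̄z) = z / (1 - ξ̄z) + ξ` turns multiplication by `ξ` on `L²(μ)` into
multiplication by `z` plus the term `(∫ ξu dμ)(1 - θ)`. Since `∫ ξu dμ = (u, ξ̄) = (Ωu, g)`, this is
`S̃Ω = ΩV` (`perturbedShift_clarkUnitary`). On `θH²` the rank-one term vanishes because `g ∈ K_θ`,
and multiplication by `θ` is an isometry of `H²` onto `θH²` commuting with `S`. Gluing the two
pieces gives the equivalence with `S ⊕ V`; `1` is not an eigenvalue because `ξ = 1` only at a
`μ`-null point. -/

theorem denseRange_linearCombination_of_total {ι G : Type*} [NormedAddCommGroup G]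
    [InnerProductSpace ℂ G] [CompleteSpace G] (v : ι → G)
    (hv : ∀ x : G, (∀ i, ⟪v i, x⟫_ℂ = 0) → x = 0) :
    DenseRange (Finsupp.linearCombination ℂ v) := by
  have : (LinearMap.range (Finsupp.linearCombination ℂ v)).topologicalClosure = ⊤ := by
    rw [Submodule.topologicalClosure_eq_top_iff, Submodule.eq_bot_iff]
    intro x hx
    refine hv x fun i => hx (v i) ?_
    rw [Finsupp.range_linearCombination]
    exact Submodule.subset_span ⟨i, rfl⟩
  exact Submodule.dense_iff_topologicalClosure_eq_top.mpr this

/-- Two total families with the same Gram matrix are intertwined by a unitary operator. -/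
theorem exists_linearIsometryEquiv_of_inner_eq {ι E F : Type*} [NormedAddCommGroup E]
    [InnerProductSpace ℂ E] [CompleteSpace E] [NormedAddCommGroup F] [InnerProductSpace ℂ F]
    [CompleteSpace F] (u : ι → E) (k : ι → F)
    (hu : ∀ x : E, (∀ i, ⟪u i, x⟫_ℂ = 0) → x = 0) (hk : ∀ y : F, (∀ i, ⟪k i, y⟫_ℂ = 0) → y = 0)
    (h : ∀ i j, ⟪u i, u j⟫_ℂ = ⟪k i, k j⟫_ℂ) :
    ∃ U : E ≃ₗᵢ[ℂ] F, ∀ i, U (u i) = k i := by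
  -- Both squared norms are the same quadratic form in the coefficients, the one given by the common
  -- Gram matrix.
  have hnorm : ∀ x : ι →₀ ℂ, ‖Finsupp.linearCombination ℂ k (LinearEquiv.refl ℂ _ x)‖ =
      ‖Finsupp.linearCombination ℂ u x‖ := by
    intro x
    have : ⟪Finsupp.linearCombination ℂ k x, Finsupp.linearCombination ℂ k x⟫_ℂ =
        ⟪Finsupp.linearCombination ℂ u x, Finsupp.linearCombination ℂ u x⟫_ℂ := by
      simp only [Finsupp.linearCombination_apply, Finsupp.sum_inner, Finsupp.inner_sum,
        inner_smul_left, inner_smul_right, h]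
    rw [inner_self_eq_norm_sq_to_K, inner_self_eq_norm_sq_to_K] at this
    have h2 : ‖Finsupp.linearCombination ℂ k x‖ ^ 2 = ‖Finsupp.linearCombination ℂ u x‖ ^ 2 := by
      exact_mod_cast this
    exact (sq_eq_sq₀ (norm_nonneg _) (norm_nonneg _)).mp h2
  have hdu := denseRange_linearCombination_of_total u hu
  have hdk := denseRange_linearCombination_of_total k hk
  refine ⟨(LinearEquiv.refl ℂ (ι →₀ ℂ)).extendOfIsometry (Finsupp.linearCombination ℂ u)
    (Finsupp.linearCombination ℂ k) hdu hdk hnorm, fun i => ?_⟩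
  have := LinearEquiv.extendOfIsometry_eq (LinearEquiv.refl ℂ (ι →₀ ℂ)) _ _ hdu hdk
    hnorm (Finsupp.single i 1)
  simpa using this

theorem coeff_eq_zero_of_hasSum_zero {a : ℕ → ℂ}
    (h : ∀ z : ℂ, ‖z‖ < 1 → HasSum (fun n => a n * z ^ n) 0) : a = 0 := by
  have h1 : HasFPowerSeriesAt (0 : ℂ → ℂ) (FormalMultilinearSeries.ofScalars ℂ a) 0 := by
    rw [hasFPowerSeriesAt_iff]
    filter_upwards [Metric.ball_mem_nhds (0 : ℂ) one_pos] with z hz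
    simpa [FormalMultilinearSeries.coeff_ofScalars, mul_comm] using h z (by simpa using hz)
  have h2 := h1.eq_zero
  funext n
  rw [← FormalMultilinearSeries.coeff_ofScalars (p := a) (n := n), h2]
  simp [FormalMultilinearSeries.coeff]

theorem coeff_unique_of_hasSum {a b : ℕ → ℂ} {s : ℂ → ℂ}
    (ha : ∀ z : ℂ, ‖z‖ < 1 → HasSum (fun n => a n * z ^ n) (s z))
    (hb : ∀ z : ℂ, ‖z‖ < 1 → HasSum (fun n => b n * z ^ n) (s z)) : a = b := by
  have := coeff_eq_zero_of_hasSum_zero (a := a - b) fun z hz => by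
    simpa [sub_mul] using (ha z hz).sub (hb z hz)
  exact sub_eq_zero.mp this

/-! ### The independent variable -/

theorem norm_xi (t : Torus) : ‖xi t‖ = 1 := by
  rw [fourier_apply]; exact Circle.norm_coe _

theorem fourier_natCast (n : ℕ) (t : Torus) : fourier (n : ℤ) t = xi t ^ n := by
  induction n with
  | zero => simp
  | succ n ih => push_cast; rw [fourier_add, ih, pow_succ]

theorem conj_xi_mul_self (t : Torus) : conj (xi t) * xi t = 1 := by
  rw [mul_comm, Complex.mul_conj, Complex.normSq_eq_norm_sq, norm_xi]; simp

theorem xi_mul_conj_self (t : Torus) : xi t * conj (xi t) = 1 := by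
  rw [mul_comm, conj_xi_mul_self]

theorem one_sub_conj_xi_mul_ne_zero (t : Torus) {z : ℂ} (hz : ‖z‖ < 1) :
    1 - conj (xi t) * z ≠ 0 := by
  intro h
  have h1 : ‖conj (xi t) * z‖ = 1 := by rw [← sub_eq_zero.mp h]; simp
  rw [norm_mul, RCLike.norm_conj, norm_xi, one_mul] at h1
  linarith

/-! ### The Hardy space -/

theorem fourierCoeff_eq_inner (f : L2 leb) (n : ℤ) :
    fourierCoeff f n = ⟪(fourierLp 2 n : L2 leb), f⟫_ℂ := by
  rw [← fourierBasis_repr, HilbertBasis.repr_apply_apply, coe_fourierBasis]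

theorem isClosed_H2 : IsClosed (H2 : Set (L2 leb)) := by
  have : (H2 : Set (L2 leb)) =
      ⋂ n : ℤ, ⋂ _ : n < 0, {f : L2 leb | ⟪(fourierLp 2 n : L2 leb), f⟫_ℂ = 0} := by
    ext f
    simp only [Set.mem_iInter, Set.mem_ofPred_eq, ← fourierCoeff_eq_inner]
    rfl
  rw [this]
  exact isClosed_iInter fun n => isClosed_iInter fun _ =>
    isClosed_eq (by fun_prop) continuous_const

instance completeSpace_H2 : CompleteSpace H2 := isClosed_H2.completeSpace_coe

/-- The Taylor coefficients of a function of the Hardy space. -/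
def coeffH2 (f : H2) (n : ℕ) : ℂ := fourierCoeff (f : L2 leb) n

theorem fourierCoeff_L2_ext {f g : L2 leb} (h : ∀ n : ℤ, fourierCoeff f n = fourierCoeff g n) :
    f = g := by
  apply fourierBasis.repr.injective
  ext n
  simpa only [fourierBasis_repr] using h n

theorem H2_ext {f g : H2} (h : ∀ n, coeffH2 f n = coeffH2 g n) : f = g := by
  refine Subtype.ext (fourierCoeff_L2_ext fun n => ?_)
  rcases lt_or_ge n 0 with hn | hn
  · rw [f.2 n hn, g.2 n hn]
  · lift n to ℕ using hn
    exact h n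

theorem hasSum_int_iff_nat {a : ℤ → ℂ} {s : ℂ} (ha : ∀ n < 0, a n = 0) :
    HasSum a s ↔ HasSum (fun n : ℕ => a n) s := by
  refine (Function.Injective.hasSum_iff Nat.cast_injective fun n hn => ha n ?_).symm
  by_contra hn'
  exact hn ⟨n.toNat, Int.toNat_of_nonneg (not_lt.mp hn')⟩

theorem hasSum_inner_H2 (f g : H2) :
    HasSum (fun n => conj (coeffH2 f n) * coeffH2 g n) ⟪f, g⟫_ℂ := by
  have h := fourierBasis.hasSum_inner_mul_inner (f : L2 leb) (g : L2 leb)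
  simp only [coe_fourierBasis, ← fourierCoeff_eq_inner] at h
  refine (hasSum_int_iff_nat (a := fun n => conj (fourierCoeff (f : L2 leb) n) *
    fourierCoeff (g : L2 leb) n) fun n hn => by rw [g.2 n hn, mul_zero]).mp ?_
  simp only [fourierCoeff_eq_inner (f : L2 leb), inner_conj_symm]
  exact h

theorem hasSum_norm_sq_H2 (f : H2) : HasSum (fun n => ‖coeffH2 f n‖ ^ 2) (‖f‖ ^ 2) := by
  have h := hasSum_inner_H2 f f
  rw [inner_self_eq_norm_sq_to_K (𝕜 := ℂ) f] at h
  simp only [Complex.conj_mul'] at h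
  rw [← Complex.hasSum_ofReal]
  simpa using h

theorem exists_H2_of_summable {a : ℕ → ℂ} (ha : Summable fun n => ‖a n‖ ^ 2) :
    ∃ f : H2, ∀ n, coeffH2 f n = a n := by
  let b : ℤ → ℂ := fun n => if n < 0 then 0 else a n.toNat
  have hb : Memℓp b 2 := by
    rw [memℓp_gen_iff (by norm_num)]
    have h1 : Function.support (fun n => ‖b n‖ ^ (2 : ℝ≥0∞).toReal) ⊆ Set.range ((↑) : ℕ → ℤ) := by
      intro n hn
      by_contra hn'
      have : n < 0 := by
        by_contra h
        exact hn' ⟨n.toNat, Int.toNat_of_nonneg (not_lt.mp h)⟩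
      exact hn (by simp [b, this])
    rw [← Function.Injective.summable_iff (g := ((↑) : ℕ → ℤ)) Nat.cast_injective
      (fun n hn => by_contra fun h => hn (h1 h))]
    have h2 : ∀ n : ℕ, b n = a n := fun n => by simp [b]
    simpa [Function.comp_def, h2] using ha
  let f : L2 leb := fourierBasis.repr.symm ⟨b, hb⟩
  have hf : ∀ n, fourierCoeff f n = b n := fun n => by
    rw [← fourierBasis_repr, LinearIsometryEquiv.apply_symm_apply]
  refine ⟨⟨f, fun n hn => by rw [hf]; simp [b, hn]⟩, fun n => ?_⟩
  change fourierCoeff f n = a n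
  rw [hf]
  simp [b]

theorem summable_szego {w : ℂ} (hw : ‖w‖ < 1) : Summable fun n : ℕ => ‖conj w ^ n‖ ^ 2 := by
  simp only [norm_pow, RCLike.norm_conj, ← pow_mul, mul_comm _ 2]
  simp only [pow_mul]
  exact summable_geometric_of_lt_one (by positivity) (by nlinarith [norm_nonneg w])

/-- The reproducing kernel of the Hardy space. -/
def szego (w : Metric.ball (0 : ℂ) 1) : H2 :=
  (exists_H2_of_summable (summable_szego (mem_ball_zero_iff.mp w.2))).choose

theorem coeffH2_szego (w : Metric.ball (0 : ℂ) 1) (n : ℕ) :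
    coeffH2 (szego w) n = conj (w : ℂ) ^ n :=
  (exists_H2_of_summable (summable_szego (mem_ball_zero_iff.mp w.2))).choose_spec n

theorem norm_ball (w : Metric.ball (0 : ℂ) 1) : ‖(w : ℂ)‖ < 1 := mem_ball_zero_iff.mp w.2

theorem hasSum_diskValue' (f : H2) (w : Metric.ball (0 : ℂ) 1) :
    HasSum (fun n => coeffH2 f n * (w : ℂ) ^ n) ⟪szego w, f⟫_ℂ := by
  have h := hasSum_inner_H2 (szego w) f
  simpa only [coeffH2_szego, map_pow, Complex.conj_conj, mul_comm] using h

theorem inner_szego (f : H2) (w : Metric.ball (0 : ℂ) 1) : ⟪szego w, f⟫_ℂ = diskValue f w :=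
  (hasSum_diskValue' f w).tsum_eq.symm

theorem hasSum_diskValue (f : H2) {z : ℂ} (hz : ‖z‖ < 1) :
    HasSum (fun n => coeffH2 f n * z ^ n) (diskValue f z) := by
  have := hasSum_diskValue' f ⟨z, mem_ball_zero_iff.mpr hz⟩
  rwa [inner_szego] at this

theorem diskValue_injective {f g : H2} (h : ∀ z : ℂ, ‖z‖ < 1 → diskValue f z = diskValue g z) :
    f = g := by
  refine H2_ext fun n => congrFun (coeff_unique_of_hasSum (s := diskValue f)
    (fun z hz => hasSum_diskValue f hz) fun z hz => ?_) n
  rw [h z hz]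
  exact hasSum_diskValue g hz

theorem ofDisk_eq {F : ℂ → ℂ} {f : H2} (h : ∀ z : ℂ, ‖z‖ < 1 → diskValue f z = F z) :
    ofDisk F = f := by
  have hex : ∃ f : H2, ∀ z : ℂ, ‖z‖ < 1 → diskValue f z = F z := ⟨f, h⟩
  rw [ofDisk, dif_pos hex]
  exact diskValue_injective fun z hz => by rw [hex.choose_spec z hz, h z hz]

/-- Evaluation at a point of the ball is the inner product with `szego`, so its linearity needs no
summability argument. -/
theorem diskValue_add (f g : H2) (z : Metric.ball (0 : ℂ) 1) :
    diskValue (f + g) z = diskValue f z + diskValue g z := by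
  simp only [← inner_szego, inner_add_right]

theorem diskValue_sub (f g : H2) (z : Metric.ball (0 : ℂ) 1) :
    diskValue (f - g) z = diskValue f z - diskValue g z := by
  simp only [← inner_szego, inner_sub_right]

theorem diskValue_smul (c : ℂ) (f : H2) (z : Metric.ball (0 : ℂ) 1) :
    diskValue (c • f) z = c * diskValue f z := by
  rw [← inner_szego, ← inner_szego]
  exact inner_smul_right (𝕜 := ℂ) (szego z) f c

theorem diskValue_szego (w z : Metric.ball (0 : ℂ) 1) :
    diskValue (szego w) z = (1 - conj (w : ℂ) * z)⁻¹ := by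
  have h := hasSum_diskValue (szego w) (norm_ball z)
  simp only [coeffH2_szego, ← mul_pow] at h
  refine h.unique (hasSum_geometric_of_norm_lt_one ?_)
  rw [norm_mul, RCLike.norm_conj]
  nlinarith [norm_nonneg (w : ℂ), norm_nonneg (z : ℂ), norm_ball w, norm_ball z]

theorem diskValue_oneH2 {z : ℂ} (hz : ‖z‖ < 1) : diskValue oneH2 z = 1 := by
  refine (hasSum_diskValue oneH2 hz).unique ?_
  have h : ∀ n : ℕ, coeffH2 oneH2 n = if n = 0 then 1 else 0 := by
    intro n
    change fourierCoeff (fourierLp 2 0 : L2 leb) n = _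
    rw [fourierCoeff_toLp, fourierCoeff_fourier, Pi.single_apply]
    simp
  convert hasSum_ite_eq 0 (1 : ℂ) using 2 with n
  rw [h]
  split_ifs with hn <;> simp [hn]

theorem fourierCoeff_mulXi (f : L2 leb) (n : ℤ) :
    fourierCoeff (mulXi leb f) n = fourierCoeff f (n - 1) := by
  rw [fourierCoeff_congr_ae (coeFn_mulXi leb f)]
  unfold fourierCoeff
  refine integral_congr_ae (Filter.Eventually.of_forall fun t => ?_)
  simp only [smul_eq_mul]
  rw [← mul_assoc, ← fourier_add, show -n + 1 = -(n - 1) by ring]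

theorem coeffH2_shift_zero (f : H2) : coeffH2 (shift f) 0 = 0 := by
  change fourierCoeff (mulXi leb f) _ = 0
  rw [fourierCoeff_mulXi]
  exact f.2 _ (by simp)

theorem coeffH2_shift_succ (f : H2) (n : ℕ) : coeffH2 (shift f) (n + 1) = coeffH2 f n := by
  change fourierCoeff (mulXi leb f) _ = _
  rw [fourierCoeff_mulXi, coeffH2]
  simp

theorem diskValue_shift (f : H2) {z : ℂ} (hz : ‖z‖ < 1) :
    diskValue (shift f) z = z * diskValue f z := by
  refine (hasSum_diskValue _ hz).unique ?_
  rw [← hasSum_nat_add_iff' 1]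
  simp only [coeffH2_shift_succ, Finset.range_one, Finset.sum_singleton, coeffH2_shift_zero,
    zero_mul, sub_zero]
  refine ((hasSum_diskValue f hz).mul_left z).congr_fun fun n => ?_
  ring

/-! ### Power series on the disk and their dilations -/

theorem integrable_of_continuous {μ : Measure Torus} [IsFiniteMeasure μ] {E : Type*}
    [NormedAddCommGroup E] {f : Torus → E} (hf : Continuous f) : Integrable f μ :=
  hf.integrable_of_hasCompactSupport (HasCompactSupport.of_compactSpace _)

theorem summable_norm_of_hasSum {a : ℕ → ℂ} {s : ℂ → ℂ}
    (hs : ∀ z : ℂ, ‖z‖ < 1 → HasSum (fun n => a n * z ^ n) (s z)) {r : ℝ} (hr0 : 0 ≤ r)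
    (hr : r < 1) : Summable fun n => ‖a n‖ * r ^ n := by
  have h := (hs r (by simpa [abs_of_nonneg hr0] using hr)).summable.norm
  simpa [abs_of_nonneg hr0] using h

theorem differentiableOn_of_hasSum {a : ℕ → ℂ} {s : ℂ → ℂ}
    (hs : ∀ z : ℂ, ‖z‖ < 1 → HasSum (fun n => a n * z ^ n) (s z)) :
    DifferentiableOn ℂ s (Metric.ball 0 1) := by
  intro z hz
  obtain ⟨r, hzr, hr⟩ := exists_between (mem_ball_zero_iff.mp hz)
  have hr0 : 0 ≤ r := (norm_nonneg z).trans hzr.le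
  have h := Complex.differentiableOn_tsum_of_summable_norm (F := fun n w => a n * w ^ n)
    (U := Metric.ball (0 : ℂ) r)
    (summable_norm_of_hasSum hs hr0 hr) (fun n => by fun_prop) Metric.isOpen_ball
    fun n w hw => by
      rw [norm_mul, norm_pow]
      have := (mem_ball_zero_iff.mp hw).le
      gcongr
  have h2 : DifferentiableOn ℂ s (Metric.ball 0 r) := h.congr fun w hw =>
    (hs w ((mem_ball_zero_iff.mp hw).trans hr)).tsum_eq.symm
  exact (h2.differentiableAt (Metric.isOpen_ball.mem_nhds
    (mem_ball_zero_iff.mpr hzr))).differentiableWithinAt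

theorem norm_mul_xi {r : ℝ} (hr0 : 0 ≤ r) (t : Torus) : ‖(r : ℂ) * xi t‖ = r := by
  rw [norm_mul, norm_xi, mul_one, Complex.norm_real, Real.norm_of_nonneg hr0]

theorem continuous_dilation {s : ℂ → ℂ} (hs : ContinuousOn s (Metric.ball 0 1)) {r : ℝ}
    (hr0 : 0 ≤ r) (hr : r < 1) : Continuous fun t : Torus => s (r * xi t) :=
  hs.comp_continuous (by fun_prop) fun t => by
    rw [mem_ball_zero_iff, norm_mul_xi hr0]; exact hr

/-- On the circle of radius `r < 1` the power series converges absolutely and uniformly, so it may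
be integrated term by term against a character. -/
theorem hasSum_fourierCoeff_dilation {a : ℕ → ℂ} {s : ℂ → ℂ}
    (hs : ∀ z : ℂ, ‖z‖ < 1 → HasSum (fun n => a n * z ^ n) (s z)) {r : ℝ} (hr0 : 0 ≤ r)
    (hr : r < 1) (k : ℤ) :
    HasSum (fun n : ℕ => if (n : ℤ) = k then a n * (r : ℂ) ^ n else 0)
      (fourierCoeff (fun t => s (r * xi t)) k) := by
  have hint : ∀ n : ℕ, ∫ t, fourier (-k) t * (a n * (r * xi t) ^ n) ∂leb =
      if (n : ℤ) = k then a n * (r : ℂ) ^ n else 0 := by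
    intro n
    have h1 : fourierCoeff (fourier (n : ℤ) : Torus → ℂ) k = if (n : ℤ) = k then 1 else 0 := by
      rw [fourierCoeff_fourier, Pi.single_apply]
      simp [eq_comm]
    calc ∫ t, fourier (-k) t * (a n * (r * xi t) ^ n) ∂leb
        = ∫ t, (a n * (r : ℂ) ^ n) * (fourier (-k) t • fourier (n : ℤ) t) ∂leb := by
          refine integral_congr_ae (Eventually.of_forall fun t => ?_)
          simp only [fourier_natCast, smul_eq_mul]
          ring
      _ = (a n * (r : ℂ) ^ n) * fourierCoeff (fourier (n : ℤ) : Torus → ℂ) k := by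
          rw [integral_const_mul]; rfl
      _ = _ := by rw [h1]; split_ifs <;> simp
  have hnorm : ∀ (n : ℕ) (t : Torus), ‖fourier (-k) t * (a n * (r * xi t) ^ n)‖ =
      ‖a n‖ * r ^ n := by
    intro n t
    rw [norm_mul, norm_mul, norm_pow, norm_mul_xi hr0, fourier_apply, Circle.norm_coe, one_mul]
  have h := hasSum_integral_of_summable_integral_norm (μ := leb)
    (F := fun (n : ℕ) (t : Torus) => fourier (-k) t * (a n * (r * xi t) ^ n))
    (fun n => integrable_of_continuous (by fun_prop)) (by
      simp only [hnorm, integral_const, probReal_univ, one_smul]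
      exact summable_norm_of_hasSum hs hr0 hr)
  simp only [hint] at h
  suffices heq : fourierCoeff (fun t => s (r * xi t)) k =
      ∫ t, ∑' n : ℕ, fourier (-k) t * (a n * (r * xi t) ^ n) ∂leb by rw [heq]; exact h
  unfold fourierCoeff
  refine integral_congr_ae (Eventually.of_forall fun t => ?_)
  have := (hs (r * xi t) (by rw [norm_mul_xi hr0]; exact hr)).mul_left (fourier (-k) t)
  exact this.tsum_eq.symm

theorem fourierCoeff_dilation_nat {a : ℕ → ℂ} {s : ℂ → ℂ}
    (hs : ∀ z : ℂ, ‖z‖ < 1 → HasSum (fun n => a n * z ^ n) (s z)) {r : ℝ} (hr0 : 0 ≤ r)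
    (hr : r < 1) (k : ℕ) : fourierCoeff (fun t => s (r * xi t)) k = a k * (r : ℂ) ^ k := by
  refine (hasSum_fourierCoeff_dilation hs hr0 hr k).unique ?_
  simp only [Nat.cast_inj]
  convert hasSum_ite_eq k (a k * (r : ℂ) ^ k) using 2 with n
  split_ifs with h <;> simp [h]

theorem fourierCoeff_dilation_neg {a : ℕ → ℂ} {s : ℂ → ℂ}
    (hs : ∀ z : ℂ, ‖z‖ < 1 → HasSum (fun n => a n * z ^ n) (s z)) {r : ℝ} (hr0 : 0 ≤ r)
    (hr : r < 1) {k : ℤ} (hk : k < 0) : fourierCoeff (fun t => s (r * xi t)) k = 0 := by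
  refine (hasSum_fourierCoeff_dilation hs hr0 hr k).unique ?_
  convert (hasSum_zero : HasSum (fun _ : ℕ => (0 : ℂ)) 0) using 2 with n
  exact if_neg (by omega)

theorem exists_H2_dilation {a : ℕ → ℂ} {s : ℂ → ℂ}
    (hs : ∀ z : ℂ, ‖z‖ < 1 → HasSum (fun n => a n * z ^ n) (s z)) {r : ℝ} (hr0 : 0 ≤ r)
    (hr : r < 1) : ∃ f : H2, (∀ n, coeffH2 f n = a n * (r : ℂ) ^ n) ∧
      (f : L2 leb) =ᵐ[leb] fun t => s (r * xi t) := by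
  let F : C(Torus, ℂ) := ⟨fun t => s (r * xi t),
    continuous_dilation (differentiableOn_of_hasSum hs).continuousOn hr0 hr⟩
  have hF : ContinuousMap.toLp (E := ℂ) 2 leb ℂ F =ᵐ[leb] fun t => s (r * xi t) :=
    ContinuousMap.coeFn_toLp (p := 2) (𝕜 := ℂ) leb F
  refine ⟨⟨ContinuousMap.toLp 2 leb ℂ F, fun n hn => ?_⟩, fun n => ?_, hF⟩
  · rw [fourierCoeff_congr_ae hF, fourierCoeff_dilation_neg hs hr0 hr hn]
  · change fourierCoeff (ContinuousMap.toLp (E := ℂ) 2 leb ℂ F) n = _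
    rw [fourierCoeff_congr_ae hF, fourierCoeff_dilation_nat hs hr0 hr]

theorem norm_sq_eq_integral {μ : Measure Torus} (f : L2 μ) :
    ‖f‖ ^ 2 = ∫ t, ‖f t‖ ^ 2 ∂μ := by
  have h := L2.inner_def (𝕜 := ℂ) f f
  rw [inner_self_eq_norm_sq_to_K] at h
  have h2 : ∫ t, ⟪f t, f t⟫_ℂ ∂μ = ((∫ t, ‖f t‖ ^ 2 ∂μ : ℝ) : ℂ) := by
    refine Eq.trans ?_ (integral_ofReal (𝕜 := ℂ))
    refine integral_congr_ae (Eventually.of_forall fun t => ?_)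
    simp only [inner_self_eq_norm_sq_to_K]
    simp
  rw [h2] at h
  exact Complex.ofReal_injective (by simpa using h)

theorem coeffH2_sub (f g : H2) (n : ℕ) : coeffH2 (f - g) n = coeffH2 f n - coeffH2 g n := by
  simp only [coeffH2, fourierCoeff_eq_inner, Submodule.coe_sub, inner_sub_right]

/-- A power series bounded by `1` on the disk belongs to the unit ball of `H^∞`. -/
theorem exists_H2_of_bounded {a : ℕ → ℂ} {s : ℂ → ℂ}
    (hs : ∀ z : ℂ, ‖z‖ < 1 → HasSum (fun n => a n * z ^ n) (s z))
    (hb : ∀ z : ℂ, ‖z‖ < 1 → ‖s z‖ ≤ 1) :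
    ∃ f : H2, (∀ z : ℂ, ‖z‖ < 1 → diskValue f z = s z) ∧
      (∀ r : ℝ, 0 ≤ r → r < 1 → ∫ t, ‖s (r * xi t)‖ ^ 2 ∂leb ≤ ‖f‖ ^ 2) ∧
      ∀ᵐ t ∂leb, ‖(f : L2 leb) t‖ ≤ 1 := by
  have hpars : ∀ r : ℝ, 0 ≤ r → r < 1 →
      HasSum (fun n => ‖a n * (r : ℂ) ^ n‖ ^ 2) (∫ t, ‖s (r * xi t)‖ ^ 2 ∂leb) := by
    intro r hr0 hr
    obtain ⟨f, hf1, hf2⟩ := exists_H2_dilation hs hr0 hr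
    have h := hasSum_norm_sq_H2 f
    simp only [hf1] at h
    convert h using 1
    rw [show ‖f‖ = ‖(f : L2 leb)‖ from rfl, norm_sq_eq_integral]
    refine integral_congr_ae ?_
    filter_upwards [hf2] with t ht
    rw [ht]
  have hle : ∀ r : ℝ, 0 ≤ r → r < 1 → ∫ t, ‖s (r * xi t)‖ ^ 2 ∂leb ≤ 1 := by
    intro r hr0 hr
    have hc := continuous_dilation (differentiableOn_of_hasSum hs).continuousOn hr0 hr
    calc ∫ t, ‖s (r * xi t)‖ ^ 2 ∂leb ≤ ∫ _, (1 : ℝ) ∂leb := by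
          refine integral_mono (integrable_of_continuous (hc.norm.pow 2)) (integrable_const _)
            fun t => ?_
          have := hb (r * xi t) (by rw [norm_mul_xi hr0]; exact hr)
          exact pow_le_one₀ (norm_nonneg _) this
      _ = 1 := by simp
  -- Each partial sum is the limit as `r → 1` of partial sums of the Parseval series at radius `r`,
  -- which are at most `1`.
  have hsum : Summable fun n => ‖a n‖ ^ 2 := by
    refine summable_of_sum_range_le (c := 1) (fun n => by positivity) fun N => ?_
    have hlim : Tendsto (fun r : ℝ => ∑ n ∈ Finset.range N, ‖a n * (r : ℂ) ^ n‖ ^ 2) (𝓝[<] 1)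
        (𝓝 (∑ n ∈ Finset.range N, ‖a n * ((1 : ℝ) : ℂ) ^ n‖ ^ 2)) := by
      refine (Continuous.tendsto ?_ 1).mono_left nhdsWithin_le_nhds
      fun_prop
    simp only [Complex.ofReal_one, one_pow, mul_one] at hlim
    refine le_of_tendsto hlim ?_
    filter_upwards [Ioo_mem_nhdsLT (zero_lt_one : (0 : ℝ) < 1)] with r hr
    exact (sum_le_hasSum _ (fun n _ => by positivity) (hpars r hr.1.le hr.2)).trans
      (hle r hr.1.le hr.2)
  obtain ⟨f, hf⟩ := exists_H2_of_summable hsum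
  have hfn := hasSum_norm_sq_H2 f
  simp only [hf] at hfn
  refine ⟨f, fun z hz => ?_, fun r hr0 hr => ?_, ?_⟩
  · have h := hasSum_diskValue f hz
    simp only [hf] at h
    exact h.unique (hs z hz)
  · refine hasSum_le (fun n => ?_) (hpars r hr0 hr) hfn
    rw [norm_mul, mul_pow, norm_pow, Complex.norm_real, Real.norm_of_nonneg hr0]
    exact mul_le_of_le_one_right (by positivity)
      (pow_le_one₀ (by positivity) (pow_le_one₀ hr0 hr.le))
  -- The dilations of radius `r k → 1` converge to `f` in `L²`, hence almost everywhere along a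
  -- subsequence, and the pointwise bound passes to the limit.
  · let r : ℕ → ℝ := fun k => 1 - 1 / ((k : ℝ) + 1)
    have hr0 : ∀ k, 0 ≤ r k := fun k => by
      have : 1 / ((k : ℝ) + 1) ≤ 1 := by
        rw [div_le_one (by positivity)]
        linarith [(Nat.cast_nonneg k : (0 : ℝ) ≤ k)]
      simpa [r] using this
    have hr1 : ∀ k, r k < 1 := fun k => by
      have : 0 < 1 / ((k : ℝ) + 1) := by positivity
      simp only [r]; linarith
    have hrlim : Tendsto r atTop (𝓝 1) := by
      simpa [r] using tendsto_const_nhds.sub (tendsto_one_div_add_atTop_nhds_zero_nat (𝕜 := ℝ))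
    choose F hF1 hF2 using fun k => exists_H2_dilation hs (hr0 k) (hr1 k)
    have hFn : ∀ k, ‖F k - f‖ ^ 2 = ∑' n, ‖a n * (r k : ℂ) ^ n - a n‖ ^ 2 := by
      intro k
      have h := hasSum_norm_sq_H2 (F k - f)
      simp only [coeffH2_sub, hF1, hf] at h
      exact h.tsum_eq.symm
    have hlim : Tendsto (fun k => ‖F k - f‖ ^ 2) atTop (𝓝 0) := by
      simp only [hFn]
      have := tendsto_tsum_of_dominated_convergence
        (f := fun k n => ‖a n * (r k : ℂ) ^ n - a n‖ ^ 2) (g := fun _ : ℕ => (0 : ℝ))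
        (bound := fun n => ‖a n‖ ^ 2) (𝓕 := atTop) hsum (fun n => ?_)
        (Eventually.of_forall fun k n => ?_)
      · simpa using this
      · have h1 : Tendsto (fun k => ‖a n * (r k : ℂ) ^ n - a n‖ ^ 2) atTop
            (𝓝 (‖a n * ((1 : ℝ) : ℂ) ^ n - a n‖ ^ 2)) :=
          (Continuous.tendsto (f := fun x : ℝ => ‖a n * (x : ℂ) ^ n - a n‖ ^ 2)
            (by fun_prop) 1).comp hrlim
        simpa using h1
      · have h1 : a n * (r k : ℂ) ^ n - a n = -(a n * ((1 - r k ^ n : ℝ) : ℂ)) := by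
          push_cast; ring
        have h2 : 0 ≤ r k ^ n := pow_nonneg (hr0 k) n
        have h3 : r k ^ n ≤ 1 := pow_le_one₀ (hr0 k) (hr1 k).le
        rw [Real.norm_of_nonneg (by positivity), h1, norm_neg, norm_mul, Complex.norm_real,
          Real.norm_of_nonneg (by linarith)]
        gcongr
        exact mul_le_of_le_one_right (norm_nonneg _) (by linarith)
    have hlim2 : Tendsto (fun k => (F k : L2 leb)) atTop (𝓝 (f : L2 leb)) := by
      rw [tendsto_iff_norm_sub_tendsto_zero]
      have := hlim.sqrt
      simp only [Real.sqrt_sq (norm_nonneg _), Real.sqrt_zero] at this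
      exact this
    obtain ⟨φ, -, hφ⟩ := (tendstoInMeasure_of_tendsto_Lp hlim2).exists_seq_tendsto_ae
    filter_upwards [hφ, ae_all_iff.mpr hF2] with t ht1 ht2
    refine le_of_tendsto ht1.norm (Eventually.of_forall fun k => ?_)
    rw [ht2]
    exact hb _ (by rw [norm_mul_xi (hr0 _)]; exact hr1 _)

/-! ### Cauchy and Herglotz integrals -/

/-- Geometric expansion of the kernel; `|ξ̄z| = |z|` is independent of `ξ`, which justifies the
interchange. -/
theorem hasSum_cauchy {μ : Measure Torus} {u : Torus → ℂ} (hu : Integrable u μ) {z : ℂ}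
    (hz : ‖z‖ < 1) :
    HasSum (fun n : ℕ => (∫ t, conj (xi t) ^ n * u t ∂μ) * z ^ n)
      (∫ t, u t / (1 - conj (xi t) * z) ∂μ) := by
  have hcont : ∀ n : ℕ, Continuous fun t : Torus => conj (xi t) ^ n := fun n => by fun_prop
  have hint : ∀ n : ℕ, Integrable (fun t => conj (xi t) ^ n * u t * z ^ n) μ := fun n =>
    (hu.bdd_mul (c := 1) (hcont n).aestronglyMeasurable
      (Eventually.of_forall fun t => by simp [Circle.norm_coe])).mul_const _
  have hnorm : ∀ (n : ℕ) (t : Torus), ‖conj (xi t) ^ n * u t * z ^ n‖ = ‖u t‖ * ‖z‖ ^ n := by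
    intro n t
    simp [Circle.norm_coe]
  have h := hasSum_integral_of_summable_integral_norm hint (by
    simp only [hnorm, integral_mul_const]
    exact (summable_geometric_of_lt_one (norm_nonneg z) hz).mul_left _)
  simp only [integral_mul_const] at h
  suffices heq : ∫ t, u t / (1 - conj (xi t) * z) ∂μ =
      ∫ t, ∑' n : ℕ, conj (xi t) ^ n * u t * z ^ n ∂μ by rw [heq]; exact h
  refine integral_congr_ae (Eventually.of_forall fun t => ?_)
  have h1 : ‖conj (xi t) * z‖ < 1 := by simpa [Circle.norm_coe] using hz
  have h2 := (hasSum_geometric_of_norm_lt_one h1).mul_left (u t)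
  refine (h2.congr_fun fun n => ?_).tsum_eq.symm
  rw [mul_pow]; ring

section Herglotz

variable (μ : Measure Torus) [IsFiniteMeasure μ]

theorem continuous_herglotz_kernel {z : ℂ} (hz : ‖z‖ < 1) :
    Continuous fun t : Torus => (1 + conj (xi t) * z) / (1 - conj (xi t) * z) :=
  Continuous.div (by fun_prop) (by fun_prop) fun t => one_sub_conj_xi_mul_ne_zero t hz

theorem continuous_cauchy_kernel {z : ℂ} (hz : ‖z‖ < 1) :
    Continuous fun t : Torus => (1 - conj (xi t) * z)⁻¹ :=
  Continuous.inv₀ (by fun_prop) fun t => one_sub_conj_xi_mul_ne_zero t hz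

/-- The Taylor coefficients of the Herglotz integral. -/
def herglotzCoeff (n : ℕ) : ℂ :=
  2 * (∫ t, conj (xi t) ^ n ∂μ) - if n = 0 then (μ.real Set.univ : ℂ) else 0

theorem herglotz_eq_cauchy {z : ℂ} (hz : ‖z‖ < 1) :
    herglotz μ z = 2 * (∫ t, 1 / (1 - conj (xi t) * z) ∂μ) - μ.real Set.univ := by
  have h1 : (μ.real Set.univ : ℂ) = ∫ _, (1 : ℂ) ∂μ := by simp
  have hi : Integrable (fun t : Torus => 1 / (1 - conj (xi t) * z)) μ := by
    simpa using integrable_of_continuous (continuous_cauchy_kernel hz)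
  rw [h1, ← integral_const_mul, ← integral_sub (hi.const_mul 2) (integrable_const _), herglotz]
  refine integral_congr_ae (Eventually.of_forall fun t => ?_)
  have := one_sub_conj_xi_mul_ne_zero t hz
  field_simp
  ring

theorem hasSum_herglotz {z : ℂ} (hz : ‖z‖ < 1) :
    HasSum (fun n => herglotzCoeff μ n * z ^ n) (herglotz μ z) := by
  have h1 := (hasSum_cauchy (integrable_const (1 : ℂ) : Integrable (fun _ => (1 : ℂ)) μ)
    hz).mul_left 2
  have h2 := h1.sub (hasSum_ite_eq 0 (μ.real Set.univ : ℂ))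
  rw [herglotz_eq_cauchy μ hz]
  refine h2.congr_fun fun n => ?_
  simp only [herglotzCoeff, mul_one]
  split_ifs with h
  · simp [h]
  · ring

/-- For `a = ξ̄z` the real part of `(1 + a) / (1 - a)` is `(1 - |a|²) / |1 - a|²`, the Poisson
kernel. -/
theorem re_herglotz_kernel_nonneg (t : Torus) {z : ℂ} (hz : ‖z‖ < 1) :
    0 ≤ ((1 + conj (xi t) * z) / (1 - conj (xi t) * z)).re := by
  set a := conj (xi t) * z with ha
  have h1 : ‖a‖ ≤ 1 := by rw [ha, norm_mul, RCLike.norm_conj, norm_xi, one_mul]; exact hz.le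
  have h2 : a.re ^ 2 + a.im ^ 2 ≤ 1 := by
    have := Complex.sq_norm a
    rw [Complex.normSq_apply] at this
    nlinarith [norm_nonneg a]
  rw [Complex.div_re, ← add_div]
  refine div_nonneg ?_ (Complex.normSq_nonneg _)
  simp only [Complex.add_re, Complex.one_re, Complex.sub_re, Complex.add_im, Complex.one_im,
    Complex.sub_im]
  nlinarith

theorem re_herglotz_nonneg {z : ℂ} (hz : ‖z‖ < 1) : 0 ≤ (herglotz μ z).re := by
  have h := integral_re (𝕜 := ℂ) (integrable_of_continuous (μ := μ) (continuous_herglotz_kernel hz))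
  simp only [RCLike.re_to_complex] at h
  rw [herglotz, ← h]
  exact integral_nonneg fun t => re_herglotz_kernel_nonneg t hz

theorem herglotz_add_one_ne_zero {z : ℂ} (hz : ‖z‖ < 1) : herglotz μ z + 1 ≠ 0 := by
  intro h
  have h1 := congrArg Complex.re h
  have h2 := re_herglotz_nonneg μ hz
  simp only [Complex.add_re, Complex.one_re, Complex.zero_re] at h1
  linarith

theorem clarkFun_ne_one {z : ℂ} (hz : ‖z‖ < 1) : clarkFun μ z ≠ 1 := by
  rw [clarkFun, ne_eq, div_eq_one_iff_eq (herglotz_add_one_ne_zero μ hz)]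
  intro h
  have := congrArg Complex.re h
  simp only [Complex.sub_re, Complex.add_re, Complex.one_re] at this
  linarith

theorem cayley_clarkFun {z : ℂ} (hz : ‖z‖ < 1) :
    (1 + clarkFun μ z) / (1 - clarkFun μ z) = herglotz μ z := by
  have h := herglotz_add_one_ne_zero μ hz
  have h2 : 1 - clarkFun μ z ≠ 0 := sub_ne_zero.mpr (clarkFun_ne_one μ hz).symm
  rw [div_eq_iff h2, clarkFun]
  field_simp
  ring

/-- The exact value is `4 Re H / |H + 1|²`, and `|H + 1| ≥ 1` since `Re H ≥ 0`. The upper bound is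
what transfers the concentration of `Re H dm` to `1 - |θ|²`. -/
theorem one_sub_norm_clarkFun_sq {z : ℂ} (hz : ‖z‖ < 1) :
    0 ≤ 1 - ‖clarkFun μ z‖ ^ 2 ∧ 1 - ‖clarkFun μ z‖ ^ 2 ≤ 4 * (herglotz μ z).re := by
  have h0 := re_herglotz_nonneg μ hz
  rw [clarkFun, norm_div, div_pow, Complex.sq_norm, Complex.sq_norm, Complex.normSq_apply,
    Complex.normSq_apply]
  simp only [Complex.sub_re, Complex.add_re, Complex.one_re, Complex.sub_im, Complex.add_im,
    Complex.one_im, sub_zero, add_zero]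
  set x := (herglotz μ z).re
  set y := (herglotz μ z).im
  have hd : 1 ≤ (x + 1) * (x + 1) + y * y := by nlinarith [mul_self_nonneg y]
  have hd0 : 0 < (x + 1) * (x + 1) + y * y := by linarith
  have heq : 1 - ((x - 1) * (x - 1) + y * y) / ((x + 1) * (x + 1) + y * y) =
      4 * x / ((x + 1) * (x + 1) + y * y) := by
    field_simp
    ring
  rw [heq]
  exact ⟨by positivity, div_le_self (by positivity) hd⟩

theorem norm_clarkFun_le_one {z : ℂ} (hz : ‖z‖ < 1) : ‖clarkFun μ z‖ ≤ 1 := by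
  have := (one_sub_norm_clarkFun_sq μ hz).1
  nlinarith [norm_nonneg (clarkFun μ z)]

theorem differentiableOn_herglotz : DifferentiableOn ℂ (herglotz μ) (Metric.ball 0 1) :=
  differentiableOn_of_hasSum fun _ hz => hasSum_herglotz μ hz

theorem exists_hasSum_clarkFun : ∃ a : ℕ → ℂ, ∀ z : ℂ, ‖z‖ < 1 →
    HasSum (fun n => a n * z ^ n) (clarkFun μ z) := by
  have hd : DifferentiableOn ℂ (clarkFun μ) (Metric.ball 0 1) :=
    ((differentiableOn_herglotz μ).sub_const 1).div ((differentiableOn_herglotz μ).add_const 1)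
      fun z hz => herglotz_add_one_ne_zero μ (mem_ball_zero_iff.mp hz)
  refine ⟨fun n => (n.factorial : ℂ)⁻¹ * iteratedDeriv n (clarkFun μ) 0, fun z hz => ?_⟩
  have h := Complex.hasSum_taylorSeries_on_ball (r := 1) (c := 0) (f := clarkFun μ) (z := z)
    (by simpa using hd) (by simpa using hz)
  refine h.congr_fun fun n => ?_
  simp only [sub_zero, smul_eq_mul]
  ring

/-! ### Boundary behaviour of the Herglotz integral -/

theorem fourierCoeff_conj (f : Torus → ℂ) (k : ℤ) :
    fourierCoeff (fun t => conj (f t)) k = conj (fourierCoeff f (-k)) := by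
  simp only [fourierCoeff, ← integral_conj, smul_eq_mul, map_mul, fourier_neg,
    neg_neg]

theorem continuous_herglotz_dilation {r : ℝ} (hr0 : 0 ≤ r) (hr : r < 1) :
    Continuous fun t : Torus => herglotz μ (r * xi t) :=
  continuous_dilation (differentiableOn_herglotz μ).continuousOn hr0 hr

/-- `Re H = (H + conj H) / 2`, and for `k ≠ 0` only one of the two summands has a nonzero
coefficient, which cancels the factor `2` in `herglotzCoeff`. For `k = 0` both contribute `μ(𝕋)`,
thanks to the mass subtracted in `herglotzCoeff μ 0`. -/
theorem integral_fourier_mul_re_herglotz {r : ℝ} (hr0 : 0 ≤ r) (hr : r < 1) (k : ℤ) :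
    ∫ t, fourier k t * ((herglotz μ (r * xi t)).re : ℂ) ∂leb =
      (r : ℂ) ^ k.natAbs * ∫ t, fourier k t ∂μ := by
  have hc := continuous_herglotz_dilation μ hr0 hr
  have h1 : ∫ t, fourier k t * ((herglotz μ (r * xi t)).re : ℂ) ∂leb =
      (fourierCoeff (fun t => herglotz μ (r * xi t)) (-k) +
        conj (fourierCoeff (fun t => herglotz μ (r * xi t)) k)) / 2 := by
    have h2 := fourierCoeff_conj (fun t => herglotz μ (r * xi t)) (-k)
    rw [neg_neg] at h2
    rw [← h2]
    unfold fourierCoeff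
    rw [← integral_add, ← integral_div]
    · refine integral_congr_ae (Eventually.of_forall fun t => ?_)
      simp only [neg_neg, smul_eq_mul, Complex.re_eq_add_conj]
      ring
    · exact integrable_of_continuous (by fun_prop)
    · exact integrable_of_continuous (by fun_prop)
  have hs : ∀ z : ℂ, ‖z‖ < 1 → _ := fun z hz => hasSum_herglotz μ hz
  rw [h1]
  rcases lt_trichotomy k 0 with hk | hk | hk
  · obtain ⟨n, rfl⟩ : ∃ n : ℕ, k = -n := ⟨k.natAbs, by omega⟩
    rw [neg_neg, fourierCoeff_dilation_neg hs hr0 hr hk, fourierCoeff_dilation_nat hs hr0 hr n]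
    have hn : n ≠ 0 := by omega
    simp only [herglotzCoeff, hn, if_false, fourier_neg, fourier_natCast, Int.natAbs_neg,
      Int.natAbs_natCast, map_zero, map_pow]
    ring
  · subst hk
    have := fourierCoeff_dilation_nat hs hr0 hr 0
    simp only [Nat.cast_zero] at this
    rw [neg_zero, this]
    have h2 : (starRingEnd ℂ) 2 = 2 := map_ofNat _ 2
    simp [herglotzCoeff, h2]
    ring
  · obtain ⟨n, rfl⟩ : ∃ n : ℕ, k = n := ⟨k.natAbs, by omega⟩
    rw [fourierCoeff_dilation_neg hs hr0 hr (by omega), fourierCoeff_dilation_nat hs hr0 hr n]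
    have hn : n ≠ 0 := by omega
    simp only [herglotzCoeff, hn, if_false, fourier_natCast, Int.natAbs_natCast, sub_zero, map_mul,
      map_pow, ← integral_conj, Complex.conj_conj, Complex.conj_ofReal, map_ofNat]
    ring

theorem integral_re_herglotz {r : ℝ} (hr0 : 0 ≤ r) (hr : r < 1) :
    ∫ t, (herglotz μ (r * xi t)).re ∂leb = μ.real Set.univ := by
  have h := integral_fourier_mul_re_herglotz μ hr0 hr 0
  simp only [fourier_zero, one_mul, Int.natAbs_zero, pow_zero, integral_const] at h
  have h2 : ∫ t, ((herglotz μ (r * xi t)).re : ℂ) ∂leb =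
      ((∫ t, (herglotz μ (r * xi t)).re ∂leb : ℝ) : ℂ) := integral_ofReal (𝕜 := ℂ)
  rw [h2] at h
  exact Complex.ofReal_injective (by simpa using h)

/-- The measures `Re H(r ξ) dm` converge weakly to `μ`. -/
theorem tendsto_integral_mul_re_herglotz (φ : C(Torus, ℂ)) :
    Tendsto (fun r : ℝ => ∫ t, φ t * ((herglotz μ (r * xi t)).re : ℂ) ∂leb) (𝓝[<] 1)
      (𝓝 (∫ t, φ t ∂μ)) := by
  have hIoo : ∀ᶠ r : ℝ in 𝓝[<] 1, r ∈ Set.Ioo (0 : ℝ) 1 := Ioo_mem_nhdsLT zero_lt_one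
  have hint : ∀ (φ : C(Torus, ℂ)) {r : ℝ}, 0 ≤ r → r < 1 →
      Integrable (fun t => φ t * ((herglotz μ (r * xi t)).re : ℂ)) leb := by
    intro φ r hr0 hr
    have hc := continuous_herglotz_dilation μ hr0 hr
    exact integrable_of_continuous (φ.continuous.mul
      (Complex.continuous_ofReal.comp (Complex.continuous_re.comp hc)))
  have hmono : ∀ φ ∈ Submodule.span ℂ (Set.range (fourier : ℤ → C(Torus, ℂ))),
      Tendsto (fun r : ℝ => ∫ t, φ t * ((herglotz μ (r * xi t)).re : ℂ) ∂leb) (𝓝[<] 1)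
        (𝓝 (∫ t, φ t ∂μ)) := by
    intro φ hφ
    induction hφ using Submodule.span_induction with
    | mem x hx =>
      obtain ⟨k, rfl⟩ := hx
      have h1 : Tendsto (fun r : ℝ => (r : ℂ) ^ k.natAbs * ∫ t, fourier k t ∂μ) (𝓝[<] 1)
          (𝓝 (((1 : ℝ) : ℂ) ^ k.natAbs * ∫ t, fourier k t ∂μ)) :=
        (Continuous.tendsto (by fun_prop) 1).mono_left nhdsWithin_le_nhds
      simp only [Complex.ofReal_one, one_pow, one_mul] at h1
      refine h1.congr' ?_
      filter_upwards [hIoo] with r hr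
      rw [integral_fourier_mul_re_herglotz μ hr.1.le hr.2]
    | zero => simp
    | add x y _ _ hx hy =>
      have h1 := hx.add hy
      rw [← integral_add (integrable_of_continuous x.continuous)
        (integrable_of_continuous y.continuous)] at h1
      refine h1.congr' ?_
      filter_upwards [hIoo] with r hr
      rw [← integral_add (hint x hr.1.le hr.2) (hint y hr.1.le hr.2)]
      simp only [ContinuousMap.add_apply, add_mul]
    | smul c x _ hx =>
      have h1 := hx.const_mul c
      simp only [← integral_const_mul] at h1
      simpa only [ContinuousMap.smul_apply, smul_eq_mul, mul_assoc] using h1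
  rw [Metric.tendsto_nhds]
  intro ε hε
  set M := μ.real Set.univ with hM
  have hM0 : 0 ≤ M := measureReal_nonneg
  -- Replacing `φ` by a trigonometric polynomial `ψ` costs at most `dist φ ψ * M` on each side,
  -- uniformly in `r`, because `Re H(rξ) dm` is a positive measure of mass `M`. The `+ 1` covers the
  -- case `M = 0`.
  have hδ : 0 < ε / (2 * M + 1) := by positivity
  have hmem : φ ∈ (Submodule.span ℂ (Set.range (fourier : ℤ → C(Torus, ℂ)))).topologicalClosure := by
    rw [span_fourier_closure_eq_top]; trivial
  obtain ⟨ψ, hψ, hd⟩ := Metric.mem_closure_iff.mp hmem _ hδ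
  have hpt : ∀ t, ‖φ t - ψ t‖ ≤ dist φ ψ := fun t => by
    rw [← dist_eq_norm]; exact ContinuousMap.dist_apply_le_dist t
  have hε' : 0 < ε - 2 * M * dist φ ψ := by
    have h3 := (lt_div_iff₀ (by positivity)).mp hd
    nlinarith [dist_nonneg (x := φ) (y := ψ)]
  filter_upwards [(Metric.tendsto_nhds.mp (hmono ψ hψ)) _ hε', hIoo] with r hr1 hr2
  have h1 : ‖(∫ t, φ t * ((herglotz μ (r * xi t)).re : ℂ) ∂leb) -
      ∫ t, ψ t * ((herglotz μ (r * xi t)).re : ℂ) ∂leb‖ ≤ dist φ ψ * M := by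
    rw [← integral_sub (hint φ hr2.1.le hr2.2) (hint ψ hr2.1.le hr2.2),
      hM, ← integral_re_herglotz μ hr2.1.le hr2.2, ← integral_const_mul]
    refine norm_integral_le_of_norm_le
      ((integrable_of_continuous (Complex.continuous_re.comp
        (continuous_herglotz_dilation μ hr2.1.le hr2.2))).const_mul _)
      (Eventually.of_forall fun t => ?_)
    rw [← sub_mul, norm_mul, Complex.norm_real, Real.norm_of_nonneg
      (re_herglotz_nonneg μ (by rw [norm_mul_xi hr2.1.le]; exact hr2.2))]
    exact mul_le_mul_of_nonneg_right (hpt t)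
      (re_herglotz_nonneg μ (by rw [norm_mul_xi hr2.1.le]; exact hr2.2))
  have h2 : ‖(∫ t, ψ t ∂μ) - ∫ t, φ t ∂μ‖ ≤ dist φ ψ * M := by
    rw [← integral_sub (integrable_of_continuous ψ.continuous)
      (integrable_of_continuous φ.continuous)]
    refine norm_integral_le_of_norm_le_const (Eventually.of_forall fun t => ?_)
    rw [norm_sub_rev]; exact hpt t
  rw [← dist_eq_norm] at h1 h2
  have h3 := dist_triangle4 (∫ t, φ t * ((herglotz μ (r * xi t)).re : ℂ) ∂leb)
    (∫ t, ψ t * ((herglotz μ (r * xi t)).re : ℂ) ∂leb) (∫ t, ψ t ∂μ) (∫ t, φ t ∂μ)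
  nlinarith

variable {μ} in
/-- A singular measure is almost carried by a compact set which is small for `m`. -/
theorem exists_continuous_of_mutuallySingular (hsing : μ.MutuallySingular leb) {ε : ℝ}
    (hε : 0 < ε) : ∃ φ : C(Torus, ℝ), (∀ t, φ t ∈ Set.Icc (0 : ℝ) 1) ∧
      ∫ t, φ t ∂μ ≤ ε ∧ ∫ t, (1 - φ t) ∂leb ≤ ε := by
  obtain ⟨s, hs, hμs, hms⟩ := hsing
  have hε' : ENNReal.ofReal ε ≠ 0 := by simpa using hε
  -- `K` is a compact subset of the `m`-null set `sᶜ` and carries all but `ε` of `μ`; `U` is an open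
  -- neighbourhood of `K` with `m(U) < ε`. The Urysohn function `φ` is `0` on `K` and `1` off `U`.
  obtain ⟨K, hKs, hK, hKm⟩ := hs.compl.exists_isCompact_lt_add (measure_ne_top μ sᶜ) hε'
  have hμK : μ Kᶜ ≤ ENNReal.ofReal ε := by
    rw [measure_compl hK.measurableSet (measure_ne_top μ K), ← measure_add_measure_compl hs, hμs,
      zero_add]
    exact tsub_le_iff_left.mpr hKm.le
  obtain ⟨U, hKU, hU, hUm⟩ := K.exists_isOpen_lt_of_lt (μ := leb) (ENNReal.ofReal ε) (by
    rw [measure_mono_null hKs hms]; exact pos_iff_ne_zero.mpr hε')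
  obtain ⟨φ, h0, h1, h01⟩ := exists_continuous_zero_one_of_isClosed hK.isClosed
    hU.isClosed_compl (Set.disjoint_compl_right_iff_subset.mpr hKU)
  refine ⟨φ, h01, ?_, ?_⟩
  · calc ∫ t, φ t ∂μ ≤ ∫ t, Kᶜ.indicator (fun _ => (1 : ℝ)) t ∂μ := by
          refine integral_mono (integrable_of_continuous φ.continuous)
            ((integrable_const _).indicator hK.measurableSet.compl) fun t => ?_
          by_cases ht : t ∈ K
          · simp [ht, h0 ht]
          · simpa [ht] using (h01 t).2
      _ = μ.real Kᶜ := by simp [integral_indicator_const, hK.measurableSet.compl]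
      _ ≤ ε := ENNReal.toReal_le_of_le_ofReal hε.le hμK
  · calc ∫ t, (1 - φ t) ∂leb ≤ ∫ t, U.indicator (fun _ => (1 : ℝ)) t ∂leb := by
          refine integral_mono (integrable_of_continuous (by fun_prop))
            ((integrable_const _).indicator hU.measurableSet) fun t => ?_
          by_cases ht : t ∈ U
          · simpa [ht] using (h01 t).1
          · simp [ht, h1 (show t ∈ Uᶜ from ht)]
      _ = leb.real U := by simp [integral_indicator_const, hU.measurableSet]
      _ ≤ ε := ENNReal.toReal_le_of_le_ofReal hε.le hUm.le

/-! ### The function `θ` is inner -/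

theorem diskValue_clarkTheta {z : ℂ} (hz : ‖z‖ < 1) :
    diskValue (clarkTheta μ) z = clarkFun μ z := by
  obtain ⟨a, ha⟩ := exists_hasSum_clarkFun μ
  obtain ⟨f, hf, -⟩ := exists_H2_of_bounded ha fun z hz => norm_clarkFun_le_one μ hz
  rw [clarkTheta, ofDisk_eq hf, hf z hz]

variable {μ} in
-- It suffices to show `‖θ‖ ≥ 1`: since `|θ| ≤ 1` almost everywhere, the nonnegative function `1 -
-- |θ|²` then has integral zero.
theorem isInner_clarkTheta (hsing : μ.MutuallySingular leb) : IsInner (clarkTheta μ) := by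
  obtain ⟨a, ha⟩ := exists_hasSum_clarkFun μ
  obtain ⟨θ, hθ, hint, hle⟩ := exists_H2_of_bounded ha fun z hz => norm_clarkFun_le_one μ hz
  rw [clarkTheta, ofDisk_eq hθ]
  have hdisk : ∀ {r : ℝ}, 0 ≤ r → r < 1 → ∀ t, ‖(r : ℂ) * xi t‖ < 1 := fun hr0 hr t => by
    rwa [norm_mul_xi hr0]
  have hnorm : 1 ≤ ‖θ‖ ^ 2 := by
    refine le_of_forall_pos_le_add fun ε hε => ?_
    -- Splitting with weights `1 - φ` and `φ` gives `1 - |θ|² ≤ (1 - φ) + 4 φ Re H` on each circle.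
    -- After integration the limit is at most `ε / 5 + 4 * (ε / 5) = ε`.
    obtain ⟨φ, h01, hφμ, hφm⟩ := exists_continuous_of_mutuallySingular hsing
      (show 0 < ε / 5 by positivity)
    have hlim : Tendsto (fun r : ℝ => ∫ t, φ t * (herglotz μ (r * xi t)).re ∂leb) (𝓝[<] 1)
        (𝓝 (∫ t, φ t ∂μ)) := by
      have h := tendsto_integral_mul_re_herglotz μ ⟨fun t => (φ t : ℂ), by fun_prop⟩
      have h1 : ∀ r : ℝ, ∫ t, (φ t : ℂ) * ((herglotz μ (r * xi t)).re : ℂ) ∂leb =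
          ((∫ t, φ t * (herglotz μ (r * xi t)).re ∂leb : ℝ) : ℂ) := fun r => by
        simp only [← Complex.ofReal_mul]
        exact integral_ofReal (𝕜 := ℂ)
      have h2 : ∫ t, (φ t : ℂ) ∂μ = ((∫ t, φ t ∂μ : ℝ) : ℂ) := integral_ofReal (𝕜 := ℂ)
      simp only [ContinuousMap.coe_mk, h1, h2] at h
      exact (Complex.continuous_re.tendsto _).comp h
    have hev : ∀ᶠ r : ℝ in 𝓝[<] 1,
        1 - ‖θ‖ ^ 2 ≤ ε / 5 + 4 * ∫ t, φ t * (herglotz μ (r * xi t)).re ∂leb := by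
      filter_upwards [Ioo_mem_nhdsLT (zero_lt_one : (0 : ℝ) < 1)] with r hr
      have hcH := continuous_herglotz_dilation μ hr.1.le hr.2
      have hcF := continuous_dilation (differentiableOn_of_hasSum ha).continuousOn hr.1.le hr.2
      have hre : Continuous fun t => φ t * (herglotz μ (r * xi t)).re :=
        φ.continuous.mul (Complex.continuous_re.comp hcH)
      have hi1 : Integrable (fun t => ‖clarkFun μ (r * xi t)‖ ^ 2) leb :=
        integrable_of_continuous (hcF.norm.pow 2)
      have hi2 : Integrable (fun t => 1 - φ t) leb := integrable_of_continuous (by fun_prop)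
      have hi3 : Integrable (fun t => 4 * (φ t * (herglotz μ (r * xi t)).re)) leb :=
        (integrable_of_continuous hre).const_mul 4
      have h1 := hint r hr.1.le hr.2
      have h2 : ∫ t, (1 - ‖clarkFun μ (r * xi t)‖ ^ 2) ∂leb ≤
          ∫ t, ((1 - φ t) + 4 * (φ t * (herglotz μ (r * xi t)).re)) ∂leb := by
        refine integral_mono ((integrable_const _).sub hi1) (hi2.add hi3) fun t => ?_
        obtain ⟨h3, h4⟩ := one_sub_norm_clarkFun_sq μ (hdisk hr.1.le hr.2 t)
        have h5 := h01 t
        have h6 := sq_nonneg ‖clarkFun μ (r * xi t)‖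
        simp only
        nlinarith [h5.1, h5.2]
      rw [integral_sub (integrable_const _) hi1, integral_add hi2 hi3, integral_const_mul] at h2
      simp only [integral_const, probReal_univ, one_smul] at h2
      linarith
    have := le_of_tendsto_of_tendsto tendsto_const_nhds
      ((hlim.const_mul 4).const_add (ε / 5)) hev
    linarith
  have hmeas : Integrable (fun t => ‖(θ : L2 leb) t‖ ^ 2) leb :=
    (Lp.memLp (θ : L2 leb)).integrable_norm_pow two_ne_zero
  have hnn : 0 ≤ᵐ[leb] fun t => 1 - ‖(θ : L2 leb) t‖ ^ 2 := by
    filter_upwards [hle] with t ht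
    have := pow_le_one₀ (n := 2) (norm_nonneg _) ht
    simpa using this
  have hz : ∫ t, (1 - ‖(θ : L2 leb) t‖ ^ 2) ∂leb = 0 := by
    refine le_antisymm ?_ (integral_nonneg_of_ae hnn)
    rw [integral_sub (integrable_const _) hmeas, ← norm_sq_eq_integral]
    simp only [integral_const, probReal_univ, one_smul]
    exact sub_nonpos.mpr hnorm
  have := (integral_eq_zero_iff_of_nonneg_ae hnn ((integrable_const _).sub hmeas)).mp hz
  filter_upwards [this] with t ht
  simp only [Pi.zero_apply] at ht
  nlinarith [norm_nonneg ((θ : L2 leb) t)]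

end Herglotz

/-! ### Multiplication by a unimodular function -/

section Unimodular

variable {μ : Measure Torus} {b : Torus → ℂ}

theorem memLp_unimodular_mul (hb : AEStronglyMeasurable b μ) (h1 : ∀ᵐ t ∂μ, ‖b t‖ = 1)
    (f : L2 μ) : MemLp (fun t => b t * f t) 2 μ := by
  refine (memLp_congr_norm (hb.mul (Lp.aestronglyMeasurable f)) (Lp.aestronglyMeasurable f)
    ?_).mpr (Lp.memLp f)
  filter_upwards [h1] with t ht
  rw [Pi.mul_apply, norm_mul, ht, one_mul]

/-- Multiplication by a unimodular function, as an isometry of `L²(μ)`. -/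
def mulUnimodular (hb : AEStronglyMeasurable b μ) (h1 : ∀ᵐ t ∂μ, ‖b t‖ = 1) :
    L2 μ →ₗᵢ[ℂ] L2 μ where
  toFun f := (memLp_unimodular_mul hb h1 f).toLp
  map_add' f g := by
    rw [← MemLp.toLp_add, MemLp.toLp_eq_toLp_iff]
    filter_upwards [Lp.coeFn_add f g] with t ht
    simp only [ht, Pi.add_apply, mul_add]
  map_smul' c f := by
    rw [RingHom.id_apply, ← MemLp.toLp_const_smul, MemLp.toLp_eq_toLp_iff]
    filter_upwards [Lp.coeFn_smul c f] with t ht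
    simp only [ht, Pi.smul_apply, smul_eq_mul]
    ring
  norm_map' f := by
    change ‖(memLp_unimodular_mul hb h1 f).toLp‖ = ‖f‖
    rw [Lp.norm_toLp, Lp.norm_def]
    congr 1
    refine eLpNorm_congr_norm_ae ?_
    filter_upwards [h1] with t ht
    rw [norm_mul, ht, one_mul]

theorem coeFn_mulUnimodular (hb : AEStronglyMeasurable b μ) (h1 : ∀ᵐ t ∂μ, ‖b t‖ = 1)
    (f : L2 μ) : mulUnimodular hb h1 f =ᵐ[μ] fun t => b t * f t :=
  (memLp_unimodular_mul hb h1 f).coeFn_toLp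

end Unimodular

section MulXi

variable (μ : Measure Torus) [IsFiniteMeasure μ]

theorem norm_mulXi (f : L2 μ) : ‖mulXi μ f‖ = ‖f‖ := by
  rw [Lp.norm_def, Lp.norm_def]
  congr 1
  refine eLpNorm_congr_norm_ae ?_
  filter_upwards [coeFn_mulXi μ f] with t ht
  rw [ht, norm_mul, norm_xi, one_mul]

theorem mulXi_surjective : Function.Surjective (mulXi μ) := by
  intro f
  have hb : AEStronglyMeasurable (fun t : Torus => conj (xi t)) μ :=
    Continuous.aestronglyMeasurable (by fun_prop)
  have h1 : ∀ᵐ t ∂μ, ‖conj (xi t)‖ = 1 :=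
    Eventually.of_forall fun t => by rw [RCLike.norm_conj, norm_xi]
  refine ⟨mulUnimodular hb h1 f, Lp.ext ?_⟩
  filter_upwards [coeFn_mulXi μ (mulUnimodular hb h1 f), coeFn_mulUnimodular hb h1 f]
    with t h2 h3
  rw [h2, h3, ← mul_assoc, xi_mul_conj_self, one_mul]

/-- Multiplication by the independent variable as a unitary operator. -/
def mulXiEquiv : L2 μ ≃ₗᵢ[ℂ] L2 μ :=
  LinearIsometryEquiv.ofSurjective ⟨(mulXi μ : L2 μ →ₗ[ℂ] L2 μ), norm_mulXi μ⟩
    (mulXi_surjective μ)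

theorem inner_mulXi (f g : L2 μ) : ⟪mulXi μ f, mulXi μ g⟫_ℂ = ⟪f, g⟫_ℂ :=
  (mulXiEquiv μ).inner_map_map f g

theorem xi_ne_one {t : Torus} (ht : t ≠ 0) : xi t ≠ 1 := by
  intro h
  refine ht (injective_toCircle (T := 1) one_ne_zero (Subtype.ext ?_))
  rw [fourier_one] at h
  rw [h, toCircle_zero]
  rfl

variable {μ} in
theorem eq_zero_of_mulXi_eq (hone : μ {0} = 0) {f : L2 μ} (h : mulXi μ f = f) : f = 0 := by
  refine Lp.ext ?_
  have h0 : ∀ᵐ t ∂μ, t ≠ 0 := by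
    rw [ae_iff]; simpa using hone
  have hf := coeFn_mulXi μ f
  rw [h] at hf
  filter_upwards [hf, h0, Lp.coeFn_zero ℂ 2 μ] with t ht ht0 hz
  rw [hz, Pi.zero_apply]
  have h2 : (xi t - 1) * f t = 0 := by rw [sub_mul, ← ht, one_mul, sub_self]
  exact (mul_eq_zero.mp h2).resolve_left (sub_ne_zero.mpr (xi_ne_one ht0))

end MulXi

/-! ### Density of the analytic polynomials in `L²(μ)` for singular `μ` -/

theorem continuous_integral_continuousMap (μ : Measure Torus) [IsFiniteMeasure μ] :
    Continuous fun φ : C(Torus, ℂ) => ∫ t, φ t ∂μ := by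
  have h : (fun φ : C(Torus, ℂ) => ∫ t, φ t ∂μ) =
      fun φ : C(Torus, ℂ) => ∫ t, (ContinuousMap.toLp 1 μ ℂ φ : Lp ℂ 1 μ) t ∂μ := by
    funext φ
    exact integral_congr_ae (ContinuousMap.coeFn_toLp (p := 1) (𝕜 := ℂ) μ φ).symm
  rw [h]
  exact continuous_integral.comp (ContinuousMap.toLp 1 μ ℂ).continuous

/-- A finite measure on the circle is determined by its Fourier coefficients. -/
theorem measure_eq_of_integral_fourier {μ ν : Measure Torus} [IsFiniteMeasure μ]
    [IsFiniteMeasure ν] (h : ∀ k : ℤ, ∫ t : Torus, fourier k t ∂μ = ∫ t : Torus, fourier k t ∂ν) :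
    μ = ν := by
  have hall : ∀ φ : C(Torus, ℂ), ∫ t, φ t ∂μ = ∫ t, φ t ∂ν := by
    intro φ
    have hmem : φ ∈ closure
        (Submodule.span ℂ (Set.range (fourier : ℤ → C(Torus, ℂ))) : Set C(Torus, ℂ)) := by
      rw [← Submodule.topologicalClosure_coe, span_fourier_closure_eq_top]; trivial
    refine closure_minimal (t := {φ : C(Torus, ℂ) | ∫ t, φ t ∂μ = ∫ t, φ t ∂ν}) ?_
      (isClosed_eq (continuous_integral_continuousMap μ) (continuous_integral_continuousMap ν)) hmem
    intro ψ hψ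
    change ∫ t, ψ t ∂μ = ∫ t, ψ t ∂ν
    induction hψ using Submodule.span_induction with
    | mem x hx => obtain ⟨k, rfl⟩ := hx; exact h k
    | zero => simp
    | add x y _ _ hx hy =>
      simp only [ContinuousMap.add_apply]
      rw [integral_add (integrable_of_continuous x.continuous)
        (integrable_of_continuous y.continuous), integral_add
        (integrable_of_continuous x.continuous) (integrable_of_continuous y.continuous), hx, hy]
    | smul c x _ hx =>
      simp only [ContinuousMap.smul_apply, smul_eq_mul, integral_const_mul, hx]
  refine ext_of_forall_integral_eq_of_IsFiniteMeasure fun f => ?_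
  have h1 := hall ⟨fun t => (f t : ℂ), by fun_prop⟩
  have h2 : ∀ ρ : Measure Torus, ∫ t, (f t : ℂ) ∂ρ = ((∫ t, f t ∂ρ : ℝ) : ℂ) := fun ρ =>
    integral_ofReal (𝕜 := ℂ)
  simp only [ContinuousMap.coe_mk, h2] at h1
  exact Complex.ofReal_injective h1

/-- If `|e|² μ` is a multiple of Lebesgue measure and `μ` is singular, then `e = 0`. -/
theorem eq_zero_of_integral_fourier_norm_sq {μ : Measure Torus} (hsing : μ.MutuallySingular leb)
    {e : L2 μ} (h : ∀ k : ℤ, k ≠ 0 → ∫ t, fourier k t * ((‖e t‖ ^ 2 : ℝ) : ℂ) ∂μ = 0) : e = 0 := by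
  have hint : Integrable (fun t => ‖e t‖ ^ 2) μ :=
    (Lp.memLp e).integrable_norm_pow two_ne_zero
  let ρ : Torus → NNReal := fun t => ‖e t‖₊ ^ 2
  have hρm : Measurable ρ := (Lp.stronglyMeasurable e).measurable.nnnorm.pow_const 2
  let ν := μ.withDensity fun t => (ρ t : ℝ≥0∞)
  have hνint : ∀ f : Torus → ℂ, ∫ t, f t ∂ν = ∫ t, f t * ((‖e t‖ ^ 2 : ℝ) : ℂ) ∂μ := by
    intro f
    rw [integral_withDensity_eq_integral_smul hρm]
    refine integral_congr_ae (Eventually.of_forall fun t => ?_)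
    simp only [ρ, NNReal.smul_def, NNReal.coe_pow, coe_nnnorm, Complex.real_smul]
    ring
  have hfin : IsFiniteMeasure ν := by
    refine isFiniteMeasure_withDensity ?_
    have := hint.lintegral_lt_top
    refine ne_of_lt (lt_of_le_of_lt (lintegral_mono fun t => le_of_eq ?_) this)
    rw [ENNReal.ofReal_eq_coe_nnreal (by positivity)]
    congr 1
  let c : NNReal := (ν Set.univ).toNNReal
  -- All Fourier coefficients of `ν = |e|² μ` of nonzero index vanish, so `ν` is its total mass
  -- times `m`.
  have hνeq : ν = c • leb := by
    refine measure_eq_of_integral_fourier fun k => ?_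
    rw [integral_smul_nnreal_measure]
    have hleb : ∫ t : Torus, fourier k t ∂leb = if k = 0 then 1 else 0 := by
      have h1 := congrFun (fourierCoeff_fourier (T := 1) k) 0
      simp only [fourierCoeff, neg_zero, fourier_zero, one_smul] at h1
      rw [h1, Pi.single_apply]
      simp [eq_comm]
    rw [hleb]
    split_ifs with hk
    · subst hk
      simp only [fourier_zero, integral_const, NNReal.smul_def, c, Measure.real]
      rfl
    · rw [hνint, h k hk, smul_zero]
  -- `ν` is both absolutely continuous with respect to `μ` and a multiple of `m`, so it vanishes on
  -- both halves of the singular decomposition.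
  have hzero : ν Set.univ = 0 := by
    obtain ⟨s, hs, hμs, hms⟩ := hsing
    have h1 : ν s = 0 := withDensity_absolutelyContinuous μ _ hμs
    have h2 : ν sᶜ = 0 := by rw [hνeq, Measure.smul_apply, hms, smul_zero]
    rw [← measure_add_measure_compl hs, h1, h2, add_zero]
  have h0 := hνint fun _ => 1
  rw [Measure.measure_univ_eq_zero.mp hzero] at h0
  simp only [integral_zero_measure, one_mul] at h0
  have h3 : ∫ t, ((‖e t‖ ^ 2 : ℝ) : ℂ) ∂μ = ((∫ t, ‖e t‖ ^ 2 ∂μ : ℝ) : ℂ) :=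
    integral_ofReal (𝕜 := ℂ)
  rw [h3, ← norm_sq_eq_integral] at h0
  have h4 : ‖e‖ ^ 2 = 0 := (Complex.ofReal_eq_zero.mp h0.symm)
  simpa using h4

section Density

variable (μ : Measure Torus) [IsFiniteMeasure μ]

/-- The monomial `ξ ^ k` as an element of `L²(μ)`. -/
def monomialL2 (k : ℤ) : L2 μ := ContinuousMap.toLp 2 μ ℂ (fourier k)

theorem coeFn_monomialL2 (k : ℤ) : monomialL2 μ k =ᵐ[μ] fun t => fourier k t :=
  ContinuousMap.coeFn_toLp (p := 2) (𝕜 := ℂ) μ (fourier k)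

theorem mulXi_monomialL2 (k : ℤ) : mulXi μ (monomialL2 μ k) = monomialL2 μ (k + 1) := by
  refine Lp.ext ?_
  filter_upwards [coeFn_mulXi μ (monomialL2 μ k), coeFn_monomialL2 μ k,
    coeFn_monomialL2 μ (k + 1)] with t h1 h2 h3
  rw [h1, h2, h3, fourier_add, mul_comm]

theorem inner_monomialL2 (k : ℤ) (u : L2 μ) :
    ⟪monomialL2 μ k, u⟫_ℂ = ∫ t, fourier (-k) t * u t ∂μ := by
  rw [L2.inner_def]
  refine integral_congr_ae ?_
  filter_upwards [coeFn_monomialL2 μ k] with t ht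
  rw [ht, RCLike.inner_apply, fourier_neg, mul_comm]

theorem eq_zero_of_forall_inner_monomialL2 {u : L2 μ} (h : ∀ k, ⟪monomialL2 μ k, u⟫_ℂ = 0) :
    u = 0 := by
  have h1 : ∀ φ : C(Torus, ℂ), ⟪(ContinuousMap.toLp 2 μ ℂ φ : L2 μ), u⟫_ℂ = 0 := by
    intro φ
    have hmem : φ ∈ closure
        (Submodule.span ℂ (Set.range (fourier : ℤ → C(Torus, ℂ))) : Set C(Torus, ℂ)) := by
      rw [← Submodule.topologicalClosure_coe, span_fourier_closure_eq_top]; trivial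
    refine closure_minimal
      (t := {φ : C(Torus, ℂ) | ⟪(ContinuousMap.toLp 2 μ ℂ φ : L2 μ), u⟫_ℂ = 0}) ?_
      (isClosed_eq ((ContinuousMap.toLp 2 μ ℂ).continuous.inner continuous_const)
        continuous_const) hmem
    intro ψ hψ
    change ⟪(ContinuousMap.toLp 2 μ ℂ ψ : L2 μ), u⟫_ℂ = 0
    induction hψ using Submodule.span_induction with
    | mem x hx => obtain ⟨k, rfl⟩ := hx; exact h k
    | zero => simp
    | add x y _ _ hx hy => rw [map_add, inner_add_left, hx, hy, add_zero]
    | smul c x _ hx => rw [map_smul, inner_smul_left, hx, mul_zero]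
  have hd : DenseRange (ContinuousMap.toLp 2 μ ℂ : C(Torus, ℂ) →L[ℂ] L2 μ) :=
    ContinuousMap.toLp_denseRange ℂ μ ℂ (by norm_num)
  have h2 : ∀ v : L2 μ, ⟪v, u⟫_ℂ = 0 := fun v =>
    hd.induction (P := fun v => ⟪v, u⟫_ℂ = 0) (by rintro _ ⟨φ, rfl⟩; exact h1 φ)
      (isClosed_eq (by fun_prop) continuous_const) v
  exact inner_self_eq_zero.mp (h2 u)

variable {μ}

/-- For singular `μ` the constant function `1` lies in the closed span of `ξ, ξ², …`. -/
theorem monomialL2_zero_mem (hsing : μ.MutuallySingular leb) :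
    monomialL2 μ 0 ∈
      (Submodule.span ℂ (Set.range fun n : ℕ => monomialL2 μ (n + 1))).topologicalClosure := by
  set N := (Submodule.span ℂ (Set.range fun n : ℕ => monomialL2 μ (n + 1))).topologicalClosure
    with hN
  have : CompleteSpace N := (Submodule.isClosed_topologicalClosure _).completeSpace_coe
  have hmemN : ∀ n : ℕ, monomialL2 μ (n + 1) ∈ N := fun n =>
    Submodule.le_topologicalClosure _ (Submodule.subset_span ⟨n, rfl⟩)
  have hVN : ∀ x ∈ N, mulXi μ x ∈ N := by
    have hle : N ≤ N.comap (mulXi μ : L2 μ →ₗ[ℂ] L2 μ) := by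
      refine Submodule.topologicalClosure_minimal _ (Submodule.span_le.mpr ?_)
        ((Submodule.isClosed_topologicalClosure _).preimage (mulXi μ).continuous)
      rintro _ ⟨n, rfl⟩
      change mulXi μ _ ∈ N
      rw [mulXi_monomialL2]
      exact_mod_cast hmemN (n + 1)
    exact hle
  -- Here `e` is the part of `1` orthogonal to `N`. Since `ξe = ξ - ξy` lies in `N`, so does every
  -- `ξ ^ (n + 1) e`; orthogonality to `e` kills the nonzero Fourier coefficients of `|e|² μ`, those
  -- of the other sign by conjugation.
  obtain ⟨y, hy, e, he, hsum⟩ := N.exists_add_mem_mem_orthogonal (monomialL2 μ 0)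
  have hVe : mulXi μ e ∈ N := by
    rw [eq_sub_iff_add_eq'.mpr hsum.symm, map_sub, mulXi_monomialL2]
    exact N.sub_mem (by simpa using hmemN 0) (hVN y hy)
  have hpow : ∀ n : ℕ, ((mulXi μ) ^ (n + 1)) e ∈ N := by
    intro n
    induction n with
    | zero => simpa using hVe
    | succ n ih => rw [pow_succ']; exact hVN _ ih
  have hcoe : ∀ n : ℕ, ((mulXi μ) ^ n) e =ᵐ[μ] fun t => fourier (n : ℤ) t * e t := by
    intro n
    induction n with
    | zero => simp
    | succ n ih =>
      rw [pow_succ']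
      filter_upwards [ih, coeFn_mulXi μ (((mulXi μ) ^ n) e)] with t h1 h2
      change (mulXi μ (((mulXi μ) ^ n) e)) t = _
      rw [h2, h1, fourier_natCast, fourier_natCast, pow_succ]
      ring
  have hneg : ∀ n : ℕ, ∫ t, fourier (-(n + 1 : ℤ)) t * ((‖e t‖ ^ 2 : ℝ) : ℂ) ∂μ = 0 := by
    intro n
    have h1 := he _ (hpow n)
    rw [L2.inner_def] at h1
    rw [← h1]
    refine integral_congr_ae ?_
    filter_upwards [hcoe (n + 1)] with t ht
    rw [ht, RCLike.inner_apply, map_mul, fourier_neg]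
    push_cast
    rw [← Complex.mul_conj']
    ring
  have he0 : e = 0 := by
    refine eq_zero_of_integral_fourier_norm_sq hsing fun k hk => ?_
    rcases lt_or_gt_of_ne hk with hk | hk
    · obtain ⟨n, rfl⟩ : ∃ n : ℕ, k = -(n + 1 : ℤ) := ⟨(-k - 1).toNat, by omega⟩
      exact hneg n
    · obtain ⟨n, rfl⟩ : ∃ n : ℕ, k = (n + 1 : ℤ) := ⟨(k - 1).toNat, by omega⟩
      have h1 := congrArg conj (hneg n)
      simpa only [← integral_conj, map_mul, fourier_neg, Complex.conj_conj, Complex.conj_ofReal,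
        map_zero] using h1
  rw [hsum, he0, add_zero]
  exact hy

/-- For singular `μ` the analytic polynomials are dense in `L²(μ)`. -/
theorem eq_zero_of_forall_integral_pow (hsing : μ.MutuallySingular leb) {u : L2 μ}
    (h : ∀ n : ℕ, ∫ t, conj (xi t) ^ n * u t ∂μ = 0) : u = 0 := by
  have hinner : ∀ (n : ℕ) (v : L2 μ),
      ⟪monomialL2 μ n, v⟫_ℂ = ∫ t, conj (xi t) ^ n * v t ∂μ := by
    intro n v
    rw [inner_monomialL2]
    simp only [fourier_neg, fourier_natCast, map_pow]
  -- Orthogonality to the analytic polynomials survives multiplication by `ξ`: against `ξ ^ (n + 1)`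
  -- because `ξ` acts isometrically, and against `1` because `1` is in the closed span of `ξ, ξ²,
  -- …`.
  have hstep : ∀ v : L2 μ, (∀ n : ℕ, ⟪monomialL2 μ n, v⟫_ℂ = 0) →
      ∀ n : ℕ, ⟪monomialL2 μ n, mulXi μ v⟫_ℂ = 0 := by
    intro v hv
    have hsucc : ∀ n : ℕ, ⟪monomialL2 μ (n + 1), mulXi μ v⟫_ℂ = 0 := fun n => by
      rw [← mulXi_monomialL2, inner_mulXi, hv n]
    have hz : ⟪monomialL2 μ 0, mulXi μ v⟫_ℂ = 0 := by
      refine closure_minimal (t := {x : L2 μ | ⟪x, mulXi μ v⟫_ℂ = 0}) ?_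
        (isClosed_eq (by fun_prop) continuous_const) (monomialL2_zero_mem hsing)
      intro x hx
      change ⟪x, mulXi μ v⟫_ℂ = 0
      induction hx using Submodule.span_induction with
      | mem x hx => obtain ⟨n, rfl⟩ := hx; exact hsucc n
      | zero => simp
      | add x y _ _ hx hy => rw [inner_add_left, hx, hy, add_zero]
      | smul c x _ hx => rw [inner_smul_left, hx, mul_zero]
    intro n
    cases n with
    | zero => exact hz
    | succ n => exact_mod_cast hsucc n
  -- Negative powers are reached through `⟪ξ ^ (-k - 1), v⟫ = ⟪ξ ^ (-k), ξ v⟫`; the induction needs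
  -- `v` universally quantified.
  have hall : ∀ (k : ℕ) (v : L2 μ), (∀ n : ℕ, ⟪monomialL2 μ n, v⟫_ℂ = 0) →
      ⟪monomialL2 μ (-k), v⟫_ℂ = 0 := by
    intro k
    induction k with
    | zero => intro v hv; simpa using hv 0
    | succ k ih =>
      intro v hv
      have h1 := ih (mulXi μ v) (hstep v hv)
      rwa [show (-(k : ℤ)) = -((k + 1 : ℕ) : ℤ) + 1 by push_cast; ring, ← mulXi_monomialL2,
        inner_mulXi] at h1
  have hu : ∀ n : ℕ, ⟪monomialL2 μ n, u⟫_ℂ = 0 := fun n => by rw [hinner, h]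
  refine eq_zero_of_forall_inner_monomialL2 μ fun k => ?_
  rcases le_total 0 k with hk | hk
  · lift k to ℕ using hk
    exact hu k
  · obtain ⟨n, rfl⟩ : ∃ n : ℕ, k = -n := ⟨k.natAbs, by omega⟩
    exact hall n u hu

end Density

/-! ### Multiplication by an inner function and the model space -/

theorem coe_shift_pow_oneH2 (n : ℕ) :
    (((shift ^ n) oneH2 : H2) : L2 leb) = fourierLp 2 (n : ℤ) := by
  induction n with
  | zero => rfl
  | succ n ih =>
    rw [pow_succ']
    change mulXi leb (((shift ^ n) oneH2 : H2) : L2 leb) = _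
    rw [ih]
    exact_mod_cast mulXi_monomialL2 leb n

theorem hasSum_coeffH2_smul (f : H2) :
    HasSum (fun n => coeffH2 f n • (shift ^ n) oneH2) f := by
  have hind : Topology.IsInducing H2.subtype := Topology.IsInducing.subtypeVal
  rw [← hind.hasSum_iff]
  have h := hasSum_fourier_series_L2 (f : L2 leb)
  rw [← Function.Injective.hasSum_iff (g := ((↑) : ℕ → ℤ)) Nat.cast_injective] at h
  · refine h.congr_fun fun n => ?_
    simp only [Function.comp_apply, map_smul, Submodule.subtype_apply, coe_shift_pow_oneH2]
    rfl
  · intro n hn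
    have hn' : n < 0 := by
      by_contra hn'
      exact hn ⟨n.toNat, Int.toNat_of_nonneg (not_lt.mp hn')⟩
    rw [f.2 n hn', zero_smul]

section Inner

variable {θ : H2} (hθ : IsInner θ)

theorem mulUnimodular_mulXi (f : L2 leb) :
    mulUnimodular (Lp.aestronglyMeasurable (θ : L2 leb)) hθ (mulXi leb f) =
      mulXi leb (mulUnimodular (Lp.aestronglyMeasurable (θ : L2 leb)) hθ f) := by
  refine Lp.ext ?_
  filter_upwards [coeFn_mulUnimodular (Lp.aestronglyMeasurable (θ : L2 leb)) hθ (mulXi leb f),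
    coeFn_mulUnimodular (Lp.aestronglyMeasurable (θ : L2 leb)) hθ f, coeFn_mulXi leb f,
    coeFn_mulXi leb (mulUnimodular (Lp.aestronglyMeasurable (θ : L2 leb)) hθ f)]
    with t h1 h2 h3 h4
  rw [h1, h4, h2, h3]
  ring

theorem mulUnimodular_oneH2 :
    mulUnimodular (Lp.aestronglyMeasurable (θ : L2 leb)) hθ (oneH2 : L2 leb) = θ := by
  refine Lp.ext ?_
  filter_upwards [coeFn_mulUnimodular (Lp.aestronglyMeasurable (θ : L2 leb)) hθ (oneH2 : L2 leb),
    coeFn_fourierLp (T := 1) 2 0] with t h1 h2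
  rw [h1]
  change _ * (fourierLp 2 0 : L2 leb) t = _
  rw [h2, fourier_zero, mul_one]

/-- Multiplication by `θ` sends `1` to `θ ∈ H²` and commutes with `ξ`, so it maps polynomials into
`H²`; density and closedness do the rest. -/
theorem mulUnimodular_mem_H2 (f : H2) :
    mulUnimodular (Lp.aestronglyMeasurable (θ : L2 leb)) hθ (f : L2 leb) ∈ H2 := by
  set M := mulUnimodular (Lp.aestronglyMeasurable (θ : L2 leb)) hθ
  have hpow : ∀ n : ℕ, M (((shift ^ n) oneH2 : H2) : L2 leb) ∈ H2 := by
    intro n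
    induction n with
    | zero =>
      change M (oneH2 : L2 leb) ∈ H2
      rw [mulUnimodular_oneH2]
      exact θ.2
    | succ n ih =>
      rw [pow_succ']
      change M (mulXi leb (((shift ^ n) oneH2 : H2) : L2 leb)) ∈ H2
      rw [mulUnimodular_mulXi]
      exact mulXi_mem_H2 ih
  have hcont : Continuous fun g : H2 => M (g : L2 leb) :=
    M.continuous.comp continuous_subtype_val
  refine (isClosed_H2.preimage hcont).mem_of_tendsto (hasSum_coeffH2_smul f)
    (Eventually.of_forall fun s => ?_)
  change M ((∑ n ∈ s, coeffH2 f n • (shift ^ n) oneH2 : H2) : L2 leb) ∈ H2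
  rw [Submodule.coe_sum, map_sum]
  refine Submodule.sum_mem _ fun n _ => ?_
  rw [Submodule.coe_smul, map_smul]
  exact H2.smul_mem _ (hpow n)

/-- Multiplication by an inner function on `H²`. -/
def mulInner : H2 →ₗᵢ[ℂ] H2 where
  toLinearMap := LinearMap.codRestrict H2
    ((mulUnimodular (Lp.aestronglyMeasurable (θ : L2 leb)) hθ).toLinearMap ∘ₗ H2.subtype)
    (mulUnimodular_mem_H2 hθ)
  norm_map' f := (mulUnimodular (Lp.aestronglyMeasurable (θ : L2 leb)) hθ).norm_map f

theorem coe_mulInner (f : H2) : (mulInner hθ f : L2 leb) =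
    mulUnimodular (Lp.aestronglyMeasurable (θ : L2 leb)) hθ f := rfl

theorem mulInner_shift (f : H2) : mulInner hθ (shift f) = shift (mulInner hθ f) :=
  Subtype.ext (mulUnimodular_mulXi hθ (f : L2 leb))

theorem mulInner_oneH2 : mulInner hθ oneH2 = θ := Subtype.ext (mulUnimodular_oneH2 hθ)

theorem mem_innerRange_iff {h : H2} : h ∈ innerRange θ ↔ ∃ f, mulInner hθ f = h := by
  refine exists_congr fun f => ⟨fun hf => Subtype.ext (Lp.ext ?_), ?_⟩
  · filter_upwards [hf, coeFn_mulUnimodular (Lp.aestronglyMeasurable (θ : L2 leb)) hθ (f : L2 leb)]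
      with t h1 h2
    rw [h1, coe_mulInner, h2]
  · rintro rfl
    exact coeFn_mulUnimodular (Lp.aestronglyMeasurable (θ : L2 leb)) hθ (f : L2 leb)

/-- Both sides are continuous in `f`, evaluation being an inner product, so monomials suffice; for
those it follows from `diskValue_shift`. -/
theorem diskValue_mulInner (f : H2) (w : Metric.ball (0 : ℂ) 1) :
    diskValue (mulInner hθ f) w = diskValue θ w * diskValue f w := by
  have hpow : ∀ n : ℕ, diskValue (mulInner hθ ((shift ^ n) oneH2)) w =
      diskValue θ w * (w : ℂ) ^ n := by
    intro n
    induction n with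
    | zero =>
      change diskValue (mulInner hθ oneH2) w = _
      rw [mulInner_oneH2, pow_zero, mul_one]
    | succ n ih =>
      rw [pow_succ']
      change diskValue (mulInner hθ (shift ((shift ^ n) oneH2))) w = _
      rw [mulInner_shift, diskValue_shift _ (norm_ball w), ih]
      ring
  have h1 := (hasSum_coeffH2_smul f).mapL
    ((innerSL ℂ (szego w)) ∘L (mulInner hθ).toContinuousLinearMap)
  have h2 := (hasSum_diskValue f (norm_ball w)).mul_left (diskValue θ w)
  rw [← inner_szego]
  refine h1.unique (h2.congr_fun fun n => ?_)
  change ⟪szego w, mulInner hθ (coeffH2 f n • (shift ^ n) oneH2)⟫_ℂ = _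
  rw [map_smul, inner_szego, diskValue_smul, hpow]
  ring

include hθ in
-- `θH²` is the range of an isometry, hence closed.
theorem isCompl_modelSpace : IsCompl (modelSpace θ) (innerRange θ) := by
  have hrange : (innerRange θ : Set H2) = Set.range (mulInner hθ) := by
    ext h; exact mem_innerRange_iff hθ
  have hcl : IsClosed (innerRange θ : Set H2) := by
    rw [hrange]
    exact (mulInner hθ).isometry.isClosedEmbedding.isClosed_range
  have : CompleteSpace (innerRange θ) := hcl.completeSpace_coe
  exact (Submodule.isCompl_orthogonal _).symm

instance completeSpace_modelSpace (θ : H2) : CompleteSpace (modelSpace θ) :=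
  inferInstanceAs (CompleteSpace (innerRange θ)ᗮ)

/-- The reproducing kernel of the model space. -/
def modelKernelH2 (w : Metric.ball (0 : ℂ) 1) : H2 :=
  szego w - conj (diskValue θ w) • mulInner hθ (szego w)

theorem inner_modelKernelH2 (w : Metric.ball (0 : ℂ) 1) (f : H2) :
    ⟪modelKernelH2 hθ w, f⟫_ℂ =
      diskValue f w - diskValue θ w * ⟪mulInner hθ (szego w), f⟫_ℂ := by
  have h := inner_smul_left (𝕜 := ℂ) (mulInner hθ (szego w)) f (conj (diskValue θ w))
  rw [Complex.conj_conj] at h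
  rw [modelKernelH2, inner_sub_left, inner_szego, ← h]

/-- Paired with `θf`, both terms of the kernel give `θ(w) f(w)`, the second because multiplication
by `θ` is an isometry. -/
theorem modelKernelH2_mem (w : Metric.ball (0 : ℂ) 1) : modelKernelH2 hθ w ∈ modelSpace θ := by
  refine (Submodule.mem_orthogonal' _ _).mpr fun h hh => ?_
  obtain ⟨f, rfl⟩ := (mem_innerRange_iff hθ).mp hh
  rw [inner_modelKernelH2, LinearIsometry.inner_map_map, inner_szego, diskValue_mulInner, sub_self]

/-- The reproducing kernel of the model space, as an element of it. -/
def modelKernel (w : Metric.ball (0 : ℂ) 1) : modelSpace θ :=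
  ⟨modelKernelH2 hθ w, modelKernelH2_mem hθ w⟩

theorem inner_modelKernel (w : Metric.ball (0 : ℂ) 1) (f : modelSpace θ) :
    ⟪modelKernel hθ w, f⟫_ℂ = diskValue f w := by
  rw [Submodule.coe_inner]
  change ⟪modelKernelH2 hθ w, (f : H2)⟫_ℂ = _
  rw [inner_modelKernelH2, f.2 _ ((mem_innerRange_iff hθ).mpr ⟨_, rfl⟩), mul_zero, sub_zero]

theorem inner_modelKernel_modelKernel (w z : Metric.ball (0 : ℂ) 1) :
    ⟪modelKernel hθ w, modelKernel hθ z⟫_ℂ =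
      (1 - conj (diskValue θ z) * diskValue θ w) / (1 - conj (z : ℂ) * w) := by
  rw [inner_modelKernel]
  change diskValue (modelKernelH2 hθ z) w = _
  rw [modelKernelH2, diskValue_sub, diskValue_smul, diskValue_mulInner, diskValue_szego]
  ring

end Inner

/-! ### The unitary operator `Ω` -/

section Omega

variable (μ : Measure Torus) [IsFiniteMeasure μ]

/-- The Cauchy kernel `1 / (1 - w̄ ξ)` as an element of `L²(μ)`. -/
def cauchyKernel (w : Metric.ball (0 : ℂ) 1) : L2 μ :=
  ContinuousMap.toLp 2 μ ℂ (star ⟨fun t : Torus => (1 - conj (xi t) * w)⁻¹,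
    continuous_cauchy_kernel (norm_ball w)⟩)

theorem coeFn_cauchyKernel (w : Metric.ball (0 : ℂ) 1) :
    cauchyKernel μ w =ᵐ[μ] fun t => conj ((1 - conj (xi t) * w)⁻¹) :=
  ContinuousMap.coeFn_toLp (p := 2) (𝕜 := ℂ) μ _

theorem inner_cauchyKernel (w : Metric.ball (0 : ℂ) 1) (u : L2 μ) :
    ⟪cauchyKernel μ w, u⟫_ℂ = ∫ t, u t / (1 - conj (xi t) * w) ∂μ := by
  rw [L2.inner_def]
  refine integral_congr_ae ?_
  filter_upwards [coeFn_cauchyKernel μ w] with t ht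
  rw [ht, RCLike.inner_apply, Complex.conj_conj, div_eq_mul_inv]

theorem one_sub_conj_mul_ne_zero (w z : Metric.ball (0 : ℂ) 1) :
    1 - conj (z : ℂ) * w ≠ 0 := by
  intro h
  have h1 : ‖conj (z : ℂ) * w‖ = 1 := by rw [← sub_eq_zero.mp h]; simp
  rw [norm_mul, RCLike.norm_conj] at h1
  nlinarith [norm_nonneg (w : ℂ), norm_nonneg (z : ℂ), norm_ball w, norm_ball z]

/-- With `a = ξ̄w` and `b = ξz̄`, `(1 + a) / (1 - a) + (1 + b) / (1 - b) = 2 (1 - ab) / ((1 - a)(1 -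
b))`, and `ab = z̄w` does not depend on `ξ`, so it leaves the integral. -/
theorem inner_cauchyKernel_cauchyKernel (w z : Metric.ball (0 : ℂ) 1) :
    ⟪cauchyKernel μ w, cauchyKernel μ z⟫_ℂ =
      (herglotz μ w + conj (herglotz μ z)) / 2 / (1 - conj (z : ℂ) * w) := by
  have hw := integrable_of_continuous (μ := μ) (continuous_herglotz_kernel (norm_ball w))
  have hz : Integrable (fun t : Torus =>
      conj ((1 + conj (xi t) * (z : ℂ)) / (1 - conj (xi t) * z))) μ :=
    integrable_of_continuous
      (Complex.continuous_conj.comp (continuous_herglotz_kernel (norm_ball z)))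
  rw [inner_cauchyKernel, herglotz, herglotz, ← integral_conj, ← integral_add hw hz,
    ← integral_div, ← integral_div]
  refine integral_congr_ae ?_
  filter_upwards [coeFn_cauchyKernel μ z] with t ht
  rw [ht]
  have h1 := one_sub_conj_xi_mul_ne_zero t (norm_ball w)
  have h2 : 1 - xi t * conj (z : ℂ) ≠ 0 := by
    have := (map_ne_zero (starRingEnd ℂ)).mpr (one_sub_conj_xi_mul_ne_zero t (norm_ball z))
    simpa only [map_sub, map_mul, map_one, Complex.conj_conj] using this
  have h3 := one_sub_conj_mul_ne_zero w z
  have h4 := conj_xi_mul_self t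
  simp only [map_inv₀, map_div₀, map_sub, map_add, map_mul, map_one, Complex.conj_conj]
  have h5 : (1 + conj (xi t) * (w : ℂ)) * (1 - xi t * conj (z : ℂ)) +
      (1 - conj (xi t) * (w : ℂ)) * (1 + xi t * conj (z : ℂ)) =
      2 * (1 - conj (z : ℂ) * w) := by
    linear_combination (-2 * (w : ℂ) * conj (z : ℂ)) * h4
  rw [inv_div_left, div_add_div _ _ h1 h2, h5, div_div, div_div, inv_eq_one_div,
    div_eq_div_iff (mul_ne_zero h1 h2) (mul_ne_zero (mul_ne_zero h1 h2) (mul_ne_zero two_ne_zero h3))]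
  ring

variable {μ}

/-- The inner products are the values of the Cauchy integral of `u`, whose Taylor coefficients are
the moments `∫ ξ̄ⁿ u dμ`. -/
theorem eq_zero_of_forall_inner_cauchyKernel (hsing : μ.MutuallySingular leb) {u : L2 μ}
    (h : ∀ w, ⟪cauchyKernel μ w, u⟫_ℂ = 0) : u = 0 := by
  have hu : Integrable u μ := (Lp.memLp u).integrable (by norm_num)
  refine eq_zero_of_forall_integral_pow hsing fun n => ?_
  refine congrFun (coeff_eq_zero_of_hasSum_zero
    (a := fun n => ∫ t, conj (xi t) ^ n * u t ∂μ) fun z hz => ?_) n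
  have h1 := hasSum_cauchy hu hz
  have h2 := h ⟨z, mem_ball_zero_iff.mpr hz⟩
  rw [inner_cauchyKernel] at h2
  rwa [h2] at h1

theorem one_sub_diskValue_ne_zero (w : Metric.ball (0 : ℂ) 1) :
    1 - diskValue (clarkTheta μ) w ≠ 0 := by
  rw [diskValue_clarkTheta μ (norm_ball w)]
  exact sub_ne_zero.mpr (clarkFun_ne_one μ (norm_ball w)).symm

theorem exists_clark_unitary (hsing : μ.MutuallySingular leb) :
    ∃ U : L2 μ ≃ₗᵢ[ℂ] modelSpace (clarkTheta μ),
      (∀ (u : L2 μ) (z : ℂ), ‖z‖ < 1 → diskValue (U u : H2) z = clarkOmegaFun μ u z) ∧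
      ∀ u v : L2 μ, ⟪(U u : H2), (U v : H2)⟫_ℂ = ⟪u, v⟫_ℂ := by
  have hθ := isInner_clarkTheta hsing
  -- The inner product is conjugate linear in its first argument; the conjugate makes `⟪k w, u⟫`
  -- equal to `(Ωu)(w)`.
  let k : Metric.ball (0 : ℂ) 1 → L2 μ := fun w =>
    conj (1 - diskValue (clarkTheta μ) w) • cauchyKernel μ w
  have hk : ∀ (w) (u : L2 μ), ⟪k w, u⟫_ℂ =
      (1 - diskValue (clarkTheta μ) w) * ⟪cauchyKernel μ w, u⟫_ℂ := fun w u => by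
    rw [inner_smul_left, Complex.conj_conj]
  have htot : ∀ u : L2 μ, (∀ w, ⟪k w, u⟫_ℂ = 0) → u = 0 := fun u hu =>
    eq_zero_of_forall_inner_cauchyKernel hsing fun w =>
      (mul_eq_zero.mp ((hk w u).symm.trans (hu w))).resolve_left (one_sub_diskValue_ne_zero w)
  have htot' : ∀ f : modelSpace (clarkTheta μ), (∀ w, ⟪modelKernel hθ w, f⟫_ℂ = 0) → f = 0 := by
    refine fun f hf => Subtype.ext (diskValue_injective fun z hz => ?_)
    have h1 := hf ⟨z, mem_ball_zero_iff.mpr hz⟩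
    rw [inner_modelKernel] at h1
    rw [h1, Submodule.coe_zero, ← inner_szego 0 ⟨z, mem_ball_zero_iff.mpr hz⟩, inner_zero_right]
  -- For `H = (1 + θ) / (1 - θ)`, the mean of `H(w)` and `conj H(z)` is `(1 - θ(w) conj θ(z)) / ((1
  -- - θ(w)) (1 - conj θ(z)))`; the normalizing factors of `k` cancel the denominator.
  have hgram : ∀ w z, ⟪k w, k z⟫_ℂ = ⟪modelKernel hθ w, modelKernel hθ z⟫_ℂ := by
    intro w z
    rw [inner_modelKernel_modelKernel, hk, inner_smul_right,
      inner_cauchyKernel_cauchyKernel, ← cayley_clarkFun μ (norm_ball w),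
      ← cayley_clarkFun μ (norm_ball z), ← diskValue_clarkTheta μ (norm_ball w),
      ← diskValue_clarkTheta μ (norm_ball z)]
    have h1 := one_sub_diskValue_ne_zero (μ := μ) w
    have h2 := (map_ne_zero (starRingEnd ℂ)).mpr (one_sub_diskValue_ne_zero (μ := μ) z)
    have h3 := one_sub_conj_mul_ne_zero w z
    simp only [map_div₀, map_sub, map_add, map_one] at h2 ⊢
    field_simp
    ring
  obtain ⟨U, hU⟩ := exists_linearIsometryEquiv_of_inner_eq k (modelKernel hθ) htot htot' hgram
  refine ⟨U, fun u z hz => ?_, fun u v => U.inner_map_map u v⟩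
  have h1 := inner_modelKernel hθ ⟨z, mem_ball_zero_iff.mpr hz⟩ (U u)
  rw [← hU, LinearIsometryEquiv.inner_map_map, hk, inner_cauchyKernel] at h1
  exact h1.symm

end Omega

/-! ### The perturbed shift -/

section Perturbation

variable {μ : Measure Torus} [IsFiniteMeasure μ] (hsing : μ.MutuallySingular leb)

/-- The operator `Ω` as a unitary operator from `L²(μ)` onto the model space. -/
def clarkUnitary : L2 μ ≃ₗᵢ[ℂ] modelSpace (clarkTheta μ) := (exists_clark_unitary hsing).choose

theorem diskValue_clarkUnitary (u : L2 μ) {z : ℂ} (hz : ‖z‖ < 1) :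
    diskValue (clarkUnitary hsing u : H2) z = clarkOmegaFun μ u z :=
  (exists_clark_unitary hsing).choose_spec.1 u z hz

theorem inner_clarkUnitary (u v : L2 μ) :
    ⟪(clarkUnitary hsing u : H2), (clarkUnitary hsing v : H2)⟫_ℂ = ⟪u, v⟫_ℂ :=
  (exists_clark_unitary hsing).choose_spec.2 u v

/-- An element of `H²` is determined by its disk values, so the choice in `ofDisk` can only return
the image under the unitary. -/
theorem clarkG_eq : clarkG μ = clarkUnitary hsing (xiBar μ) :=
  ofDisk_eq fun _ hz => diskValue_clarkUnitary hsing (xiBar μ) hz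

theorem coeFn_xiBar : xiBar μ =ᵐ[μ] fun t => conj (xi t) :=
  ContinuousMap.coeFn_toLp (p := 2) (𝕜 := ℂ) μ (star xi)

theorem inner_xiBar (u : L2 μ) : ⟪xiBar μ, u⟫_ℂ = ∫ t, xi t * u t ∂μ := by
  rw [L2.inner_def]
  refine integral_congr_ae ?_
  filter_upwards [coeFn_xiBar (μ := μ)] with t ht
  rw [ht, RCLike.inner_apply, Complex.conj_conj, mul_comm]

include hsing in
theorem clarkG_mem : clarkG μ ∈ modelSpace (clarkTheta μ) := by
  rw [clarkG_eq hsing]; exact Subtype.coe_prop _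

theorem perturbedShift_apply (h : H2) : perturbedShift μ h =
    shift h + ⟪clarkG μ, h⟫_ℂ • (oneH2 - clarkTheta μ) := rfl

/-- `ξ / (1 - ξ̄z) = z / (1 - ξ̄z) + ξ`, because `ξξ̄ = 1`. The extra term `∫ ξu dμ` is the source
of the rank-one perturbation. -/
theorem integral_mulXi_cauchy (u : L2 μ) {z : ℂ} (hz : ‖z‖ < 1) :
    ∫ t, mulXi μ u t / (1 - conj (xi t) * z) ∂μ =
      z * (∫ t, u t / (1 - conj (xi t) * z) ∂μ) + ∫ t, xi t * u t ∂μ := by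
  have hu : Integrable u μ := (Lp.memLp u).integrable (by norm_num)
  have h1 : Integrable (fun t => u t / (1 - conj (xi t) * z)) μ := by
    have h := continuous_cauchy_kernel hz
    obtain ⟨C, hC⟩ := (isCompact_range h).isBounded.exists_norm_le
    have := hu.bdd_mul (c := C) h.aestronglyMeasurable
      (Eventually.of_forall fun t => hC _ ⟨t, rfl⟩)
    simpa only [div_eq_mul_inv, mul_comm] using this
  have h2 : Integrable (fun t => xi t * u t) μ :=
    hu.bdd_mul (c := 1) (map_continuous xi).aestronglyMeasurable
      (Eventually.of_forall fun t => (norm_xi t).le)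
  rw [← integral_const_mul, ← integral_add (h1.const_mul z) h2]
  refine integral_congr_ae ?_
  filter_upwards [coeFn_mulXi μ u] with t ht
  have h3 := one_sub_conj_xi_mul_ne_zero t hz
  rw [ht, mul_div_assoc', div_add' _ _ _ h3]
  congr 1
  linear_combination (z * u t) * conj_xi_mul_self t

/-- `Ω` intertwines multiplication by `ξ` with the perturbed shift. -/
theorem perturbedShift_clarkUnitary (u : L2 μ) :
    perturbedShift μ (clarkUnitary hsing u : H2) = clarkUnitary hsing (mulXi μ u) := by
  refine diskValue_injective fun z hz => ?_
  have hadd := diskValue_add (shift (clarkUnitary hsing u : H2))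
    (⟪clarkG μ, (clarkUnitary hsing u : H2)⟫_ℂ • (oneH2 - clarkTheta μ))
    ⟨z, mem_ball_zero_iff.mpr hz⟩
  have hsmul := diskValue_smul ⟪clarkG μ, (clarkUnitary hsing u : H2)⟫_ℂ
    (oneH2 - clarkTheta μ) ⟨z, mem_ball_zero_iff.mpr hz⟩
  have hsub := diskValue_sub oneH2 (clarkTheta μ) ⟨z, mem_ball_zero_iff.mpr hz⟩
  simp only at hadd hsmul hsub
  -- Unitarity turns the coefficient `⟪g, Ωu⟫` into `⟪ξ̄, u⟫ = ∫ ξu dμ`, which matches that extra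
  -- term.
  rw [perturbedShift_apply, hadd, hsmul, hsub, diskValue_shift _ hz, diskValue_oneH2 hz,
    diskValue_clarkUnitary hsing u hz, diskValue_clarkUnitary hsing _ hz, clarkG_eq hsing,
    inner_clarkUnitary, inner_xiBar, clarkOmegaFun,
    clarkOmegaFun, integral_mulXi_cauchy u hz]
  ring

include hsing in
theorem perturbedShift_of_mem_innerRange {h : H2} (hh : h ∈ innerRange (clarkTheta μ)) :
    perturbedShift μ h = shift h := by
  have h1 : ⟪clarkG μ, h⟫_ℂ = 0 :=
    (Submodule.mem_orthogonal' _ _).mp (clarkG_mem hsing) h hh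
  rw [perturbedShift_apply, h1, zero_smul, add_zero]

theorem perturbedShift_mem_modelSpace {h : H2} (hh : h ∈ modelSpace (clarkTheta μ)) :
    perturbedShift μ h =
      clarkUnitary hsing (mulXi μ ((clarkUnitary hsing).symm ⟨h, hh⟩)) := by
  rw [← perturbedShift_clarkUnitary, LinearIsometryEquiv.apply_symm_apply]

include hsing in
-- On `K_θ` the operator is the conjugate of `V` by the Clark unitary, so a fixed vector would give
-- a fixed vector of `V`; on `θH²` it is the shift, which commutes with multiplication by `θ`.
theorem isModelPerturbation (hone : μ {0} = 0) :
    IsModelPerturbation (clarkTheta μ) (perturbedShift μ) where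
  isCompl := isCompl_modelSpace (isInner_clarkTheta hsing)
  map_modelSpace h hh := by
    rw [perturbedShift_mem_modelSpace hsing hh]
    exact Subtype.coe_prop _
  map_innerRange h hh := by
    rw [perturbedShift_of_mem_innerRange hsing hh]
    obtain ⟨f, rfl⟩ := (mem_innerRange_iff (isInner_clarkTheta hsing)).mp hh
    exact (mem_innerRange_iff (isInner_clarkTheta hsing)).mpr ⟨shift f, mulInner_shift _ f⟩
  eq_shift h hh := perturbedShift_of_mem_innerRange hsing hh
  unitary := by
    refine ⟨((clarkUnitary hsing).symm.trans (mulXiEquiv μ)).trans (clarkUnitary hsing),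
      fun h => (perturbedShift_mem_modelSpace hsing h.2).symm, fun hev => ?_⟩
    obtain ⟨h, hh, hne⟩ := hev.exists_hasEigenvector
    rw [Module.End.mem_eigenspace_iff, one_smul] at hh
    have h1 : clarkUnitary hsing (mulXi μ ((clarkUnitary hsing).symm h)) = h := hh
    have h2 : mulXi μ ((clarkUnitary hsing).symm h) = (clarkUnitary hsing).symm h := by
      rw [← (clarkUnitary hsing).symm_apply_apply (mulXi μ _), h1]
    have h3 := eq_zero_of_mulXi_eq hone h2
    have h4 : ‖h‖ = 0 :=
      ((clarkUnitary hsing).symm.norm_map h).symm.trans (by rw [h3, norm_zero])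
    exact hne (norm_eq_zero.mp h4)

/-- The decomposition `H² = θ H² ⊕ K_θ`, with both summands in their model form. -/
def clarkSum : WithLp 2 (H2 × L2 μ) →ₗᵢ[ℂ] H2 where
  toFun p := mulInner (isInner_clarkTheta hsing) p.fst + clarkUnitary hsing p.snd
  map_add' p q := by
    simp only [WithLp.add_fst, WithLp.add_snd, map_add, Submodule.coe_add]
    abel
  map_smul' c p := by
    simp only [WithLp.smul_fst, WithLp.smul_snd, map_smul, Submodule.coe_smul, smul_add,
      RingHom.id_apply]
  norm_map' p := by
    have horth : ⟪mulInner (isInner_clarkTheta hsing) p.fst,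
        (clarkUnitary hsing p.snd : H2)⟫_ℂ = 0 :=
      (clarkUnitary hsing p.snd).2 _
        ((mem_innerRange_iff (isInner_clarkTheta hsing)).mpr ⟨_, rfl⟩)
    have h1 := norm_add_sq_eq_norm_sq_add_norm_sq_of_inner_eq_zero (𝕜 := ℂ)
      (mulInner (isInner_clarkTheta hsing) p.fst) (clarkUnitary hsing p.snd : H2) horth
    have h2 := WithLp.prod_norm_sq_eq_of_L2 p
    have h3 : ‖(clarkUnitary hsing p.snd : H2)‖ = ‖p.snd‖ :=
      (clarkUnitary hsing).norm_map p.snd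
    rw [LinearIsometry.norm_map, h3] at h1
    change ‖mulInner (isInner_clarkTheta hsing) p.fst + (clarkUnitary hsing p.snd : H2)‖ = ‖p‖
    nlinarith [norm_nonneg p,
      norm_nonneg (mulInner (isInner_clarkTheta hsing) p.fst + (clarkUnitary hsing p.snd : H2))]

theorem clarkSum_apply (p : WithLp 2 (H2 × L2 μ)) : clarkSum hsing p =
    mulInner (isInner_clarkTheta hsing) p.fst + clarkUnitary hsing p.snd := rfl

theorem clarkSum_surjective : Function.Surjective (clarkSum hsing) := by
  intro h
  have hmem : h ∈ modelSpace (clarkTheta μ) ⊔ innerRange (clarkTheta μ) := by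
    rw [(isCompl_modelSpace (isInner_clarkTheta hsing)).sup_eq_top]; trivial
  obtain ⟨x, hx, y, hy, rfl⟩ := Submodule.mem_sup.mp hmem
  obtain ⟨f, rfl⟩ := (mem_innerRange_iff (isInner_clarkTheta hsing)).mp hy
  refine ⟨WithLp.toLp 2 (f, (clarkUnitary hsing).symm ⟨x, hx⟩), ?_⟩
  change mulInner _ f + (clarkUnitary hsing ((clarkUnitary hsing).symm ⟨x, hx⟩) : H2) = _
  rw [LinearIsometryEquiv.apply_symm_apply, add_comm]

theorem clarkSum_directSum (p : WithLp 2 (H2 × L2 μ)) :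
    clarkSum hsing (directSum shift (mulXi μ) p) = perturbedShift μ (clarkSum hsing p) := by
  rw [clarkSum_apply, clarkSum_apply, map_add, perturbedShift_clarkUnitary,
    perturbedShift_of_mem_innerRange hsing
      ((mem_innerRange_iff (isInner_clarkTheta hsing)).mpr ⟨_, rfl⟩), ← mulInner_shift]
  rfl

end Perturbation

end ClarkModel

end

theorem mainTheorem7 (μ : MeasureTheory.Measure ClarkModel.Torus)
    [MeasureTheory.IsFiniteMeasure μ]
    (hsing : μ.MutuallySingular ClarkModel.leb) (hone : μ {0} = 0) :
    -- `θ` is well defined: it is an inner function which satisfies the defining relation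
    (ClarkModel.IsInner (ClarkModel.clarkTheta μ) ∧
      ∀ z : ℂ, ‖z‖ < 1 → ClarkModel.diskValue (ClarkModel.clarkTheta μ) z ≠ 1 ∧
        (1 + ClarkModel.diskValue (ClarkModel.clarkTheta μ) z) /
            (1 - ClarkModel.diskValue (ClarkModel.clarkTheta μ) z) =
          ∫ t, (1 + conj (ClarkModel.xi t) * z) / (1 - conj (ClarkModel.xi t) * z) ∂μ) ∧
    -- `g` is well defined: it belongs to `K_θ` and is given by the formula for `Ω ξ̄`
    (ClarkModel.clarkG μ ∈ ClarkModel.modelSpace (ClarkModel.clarkTheta μ) ∧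
      ∀ z : ℂ, ‖z‖ < 1 → ClarkModel.diskValue (ClarkModel.clarkG μ) z =
        (1 - ClarkModel.diskValue (ClarkModel.clarkTheta μ) z) *
          ∫ t, conj (ClarkModel.xi t) / (1 - conj (ClarkModel.xi t) * z) ∂μ) ∧
    -- properties (i), (ii), (iii)
    ClarkModel.IsModelPerturbation (ClarkModel.clarkTheta μ) (ClarkModel.perturbedShift μ) ∧
    -- the restriction to `K_θ` is unitarily equivalent to multiplication by `ξ` on `L²(μ)`
    (∃ h : Set.MapsTo (ClarkModel.perturbedShift μ)
          (ClarkModel.modelSpace (ClarkModel.clarkTheta μ))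
          (ClarkModel.modelSpace (ClarkModel.clarkTheta μ)),
      ClarkModel.UnitarilyEquivalent (E := ClarkModel.modelSpace (ClarkModel.clarkTheta μ))
        ((ClarkModel.perturbedShift μ).restrict h)
        (ClarkModel.mulXi μ)) ∧
    -- the perturbed shift is unitarily equivalent to `S ⊕ V`
    ClarkModel.UnitarilyEquivalent (ClarkModel.perturbedShift μ)
      (ClarkModel.directSum ClarkModel.shift (ClarkModel.mulXi μ)) := by
  refine ⟨⟨ClarkModel.isInner_clarkTheta hsing, fun z hz => ?_⟩,
    ⟨ClarkModel.clarkG_mem hsing, fun z hz => ?_⟩, ClarkModel.isModelPerturbation hsing hone,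
    ⟨fun h hh => (ClarkModel.isModelPerturbation hsing hone).map_modelSpace h hh,
      (ClarkModel.clarkUnitary hsing).symm, fun h => ?_⟩, ?_⟩
  · rw [ClarkModel.diskValue_clarkTheta μ hz]
    exact ⟨ClarkModel.clarkFun_ne_one μ hz, ClarkModel.cayley_clarkFun μ hz⟩
  · rw [ClarkModel.clarkG_eq hsing, ClarkModel.diskValue_clarkUnitary hsing _ hz,
      ClarkModel.clarkOmegaFun]
    congr 1
    refine integral_congr_ae ?_
    filter_upwards [ClarkModel.coeFn_xiBar (μ := μ)] with t ht
    rw [ht]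
  · rw [LinearIsometryEquiv.symm_apply_eq]
    exact Subtype.ext (ClarkModel.perturbedShift_mem_modelSpace hsing h.2)
  · let W := LinearIsometryEquiv.ofSurjective (ClarkModel.clarkSum hsing)
      (ClarkModel.clarkSum_surjective hsing)
    refine ⟨W.symm, fun x => ?_⟩
    rw [LinearIsometryEquiv.symm_apply_eq]
    refine Eq.trans ?_ (ClarkModel.clarkSum_directSum hsing (W.symm x)).symm
    exact congrArg _ (W.apply_symm_apply x).symm
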